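/- Let $\mathbb F$ be a field, let $\sigma_{\mathbb F}$ be the set of monic irreducible polynomials over $\mathbb F$, and let $\mathbb N=\{1,2,\dots\}$. For $\lambda\in\mathbb F^*$ put $(\lambda\star p)(X)=\lambda^{\deg p}p(X/\lambda)$. A multiplicity function $\aleph$ assigns a cardinal to every $(p,n)\in\sigma_{\mathbb F}\times\mathbb N$. We put $[\lambda\star\aleph](\lambda\star p,n)=\aleph(p,n)$ and $\mathrm{Dil}(\aleph)=\{\lambda\in\mathbb F^*:\lambda\star\aleph=\aleph\}$. For every $p\in\sigma_{\mathbb F}$ let $x_p$ be one of the following $\deg p\times\deg p$ matrices. - $\epsilon=1$ (any $\mathbb F$): $x_p$ is the companion matrix of $p$, with ones on the subdiagonal and last column $-a_0,\dots,-a_{d-1}$, where $p=X^d+a_{d-1}X^{d-1}+\dots+a_0$. - $\epsilon=0$ ($\mathbb F=\mathbb R$): $x_p=\begin{pmatrix}a&-b\\ b&a\end{pmatrix}$ if $p$ has the roots $a\pm ib$ with $b>0$, and $x_p=\mu$ if $p=X-\mu$. Let $\mathbb F_p=\mathbb F[x_p]$, a field of $\deg p\times\deg p$ matrices. Let $N_n$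 be the $n\times n$ matrix with $N_ne_m=e_{m-1}$ and $N_ne_1=0$. Put $J(p,n)=\mathrm{id}_n\otimes x_p+N_n\otimes\mathrm{id}_{\deg p}$ on $\mathbb F_p^n\simeq\mathbb F^n\otimes\mathbb F^{\deg p}$, and let $J(\aleph)$ be the direct sum of $\aleph(p,n)$ copies of $J(p,n)$ over all $p,n$, acting on $\mathbf V=\bigoplus_{p,n}\bigoplus_{\alpha\in\aleph(p,n)}\mathbb F_p^n$. Let $\mathrm{aA}(\aleph)=\mathbb Fe_0\rtimes\mathbf V$ be the Lie algebra in which $\mathbf V$ is an Abelian ideal and $[e_0,v]=J(\aleph)v$ for $v\in\mathbf V$. Put $V_n(\lambda)=\mathrm{diag}(\lambda,\lambda^2,\dots,\lambda^n)$. Suppose that every $p\in\sigma_{\mathbb F}$ with $\aleph(p,n)\neq0$ for some $n\ge2$ is separable (which is automatic if $\mathbb F$ is perfect), and that $\mathrm{aA}(\aleph)$ is non-Abelian, indecomposable (not a direct sum of two nonzero ideals) and not isomorphic to the Heisenberg algebra (the Lie algebra with basis $x,y,z$, $[x,y]=z$ and $z$ central). Then the set of automorphisms of $\mathrm{aA}(\aleph)$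 is exactly the set of operators $$\begin{pmatrix}\nu&0\\ \gamma&\Delta\end{pmatrix},\qquad e_0\mapsto\nu e_0+\gamma,\quad v\mapsto\Delta v\ \ (v\in\mathbf V),$$ where $\nu\in\mathrm{Dil}(\aleph)$, $\gamma\in\mathbf V$ is arbitrary, and $\Delta$ is an invertible linear operator on $\mathbf V$ with the following two properties. 1. For any two blocks $(q,n,\beta)$ (row) and $(p,m,\alpha)$ (column), with $\beta\in\aleph(q,n)$ and $\alpha\in\aleph(p,m)$, $$\Delta_{q,n,\beta;p,m,\alpha}=\delta_{p,\nu\star q}\,\bigl(V_n(\nu^{-1})\otimes V_d(\nu|\nu|^{\epsilon-1})\bigr)R,\qquad d=\deg p,$$ with $\nu|\nu|^{\epsilon-1}$ read as $\nu$ if $\epsilon=1$. Here $R=R_{p;n,\beta;m,\alpha}$ is an $n\times m$ matrix over $\mathbb F_p$ whose top right $l\times l$ corner, $l=\min\{m,n\}$, is an upper triangular Toeplitz matrix with first row $r_1,\dots,r_l\in\mathbb F_p$, and whose other entries are zero. 2. For every column label $(p,m,\alpha)$ only finitely many row labels $(q,n,\beta)$ correspond to nonzero blocks. For $1\le i\le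 n$ and $1\le k\le d$, the $(i,k)$-th diagonal entry of the diagonal matrix $V_n(\nu^{-1})\otimes V_d(\nu|\nu|^{\epsilon-1})$ is $\nu^{k-i}$ if $\epsilon=1$ and $\nu^{k-i}|\nu|^{-k}$ if $\epsilon=0$. -/

import Mathlib

open Polynomial
open scoped Kronecker DirectSum

universe u w

namespace JordanableAA

/-! ### Spectrum of a field, dilations, multiplicity functions -/

/-- The spectrum of a field: the set of monic irreducible polynomials. -/
def Spec (F : Type u) [Field F] : Type u := {p : F[X] // p.Monic ∧ Irreducible p}

/-- The degree of an element of the spectrum. -/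
noncomputable def Spec.deg {F : Type u} [Field F] (p : Spec F) : ℕ := p.1.natDegree

theorem scaleRoots_irreducible {F : Type u} [Field F] {p : F[X]} (hp : Irreducible p) (c : Fˣ) :
    Irreducible (p.scaleRoots (c : F)) := by
  have hd : 0 < p.natDegree := hp.natDegree_pos
  have key : ∀ (q : F[X]) (e : Fˣ), IsUnit (q.scaleRoots (e : F)) → IsUnit q := by
    intro q e h
    rw [Polynomial.isUnit_iff_degree_eq_zero] at h ⊢
    rwa [Polynomial.degree_scaleRoots] at h
  refine ⟨fun h => hp.not_isUnit (key p c h), ?_⟩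
  intro a b hab
  have h1 : p = a.scaleRoots ((c⁻¹ : Fˣ) : F) * b.scaleRoots ((c⁻¹ : Fˣ) : F) := by
    rw [← Polynomial.mul_scaleRoots_of_noZeroDivisors, ← hab, ← Polynomial.scaleRoots_mul]
    simp
  rcases hp.isUnit_or_isUnit h1 with h | h
  · exact Or.inl (key a c⁻¹ h)
  · exact Or.inr (key b c⁻¹ h)

/-- The action `(c ⋆ p)(X) = c ^ (deg p) * p (X / c)` of the nonzero scalars on the spectrum;
`scaleRoots p c` is the polynomial `∑ₖ c ^ (deg p - k) * aₖ * X ^ k`. -/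
noncomputable instance {F : Type u} [Field F] : MulAction Fˣ (Spec F) where
  smul c p := ⟨p.1.scaleRoots (c : F),
    (Polynomial.monic_scaleRoots_iff _).2 p.2.1, scaleRoots_irreducible p.2.2 c⟩
  one_smul p := Subtype.ext (by
    change p.1.scaleRoots ((1 : Fˣ) : F) = p.1
    simp)
  mul_smul c e p := Subtype.ext (by
    change p.1.scaleRoots ((c * e : Fˣ) : F) = (p.1.scaleRoots (e : F)).scaleRoots (c : F)
    rw [Units.val_mul, mul_comm, Polynomial.scaleRoots_mul])

theorem Spec.deg_smul {F : Type u} [Field F] (c : Fˣ) (p : Spec F) : (c • p).deg = p.deg :=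
  Polynomial.natDegree_scaleRoots _ _

/-- A graded multiplicity function `ℵ : σ_F × ℕ → {cardinals}`, the grading starting at `1`. -/
def MultFun (F : Type u) [Field F] : Type (max u (w + 1)) := Spec F → ℕ+ → Cardinal.{w}

/-- The action of the nonzero scalars on multiplicity functions (push-forward). -/
noncomputable def MultFun.star {F : Type u} [Field F] (c : Fˣ) (m : MultFun.{u, w} F) :
    MultFun.{u, w} F :=
  fun p n => m (c⁻¹ • p) n

theorem MultFun.star_smul {F : Type u} [Field F] (c : Fˣ) (m : MultFun.{u, w} F) (p : Spec F)
    (n : ℕ+) : m.star c (c • p) n = m p n := by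
  simp [MultFun.star]

/-- The dilation symmetries of a multiplicity function. -/
def MultFun.Dil {F : Type u} [Field F] (m : MultFun.{u, w} F) : Set Fˣ := {c | m.star c = m}

/-! ### Jordan blocks and Jordan canonical forms -/

/-- A choice, for every `p` in the spectrum, of a `deg p × deg p` matrix `x_p`. -/
abbrev RootMatrices (F : Type u) [Field F] : Type u :=
  (p : Spec F) → Matrix (Fin p.deg) (Fin p.deg) F

/-- The matrix `x_p` given by multiplication by a root of `p` in the basis `1, x_p, x_p², …`. -/
noncomputable def companion (F : Type u) [Field F] : RootMatrices F := fun p =>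
  Matrix.of fun i j =>
    if (j : ℕ) + 1 = p.deg then - p.1.coeff i else if (i : ℕ) = j + 1 then 1 else 0

/-- The traditional real form of `x_p` over the reals: for `p = X² + a₁ X + a₀` irreducible with
roots `a ± b i`, `b > 0`, it is the matrix with rows `(a, -b)` and `(b, a)`; for `deg p = 1` it is
the root of `p`. -/
noncomputable def realForm : RootMatrices ℝ := fun p =>
  Matrix.of fun i j =>
    if p.deg = 2 then
      if i = j then - p.1.coeff 1 / 2
      else if i < j then - Real.sqrt (p.1.coeff 0 - (p.1.coeff 1 / 2) ^ 2)
      else Real.sqrt (p.1.coeff 0 - (p.1.coeff 1 / 2) ^ 2)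
    else companion ℝ p i j

/-- The nilpotent matrix `N_n` with `N_n e_m = e_{m-1}` and `N_n e_1 = 0`. -/
def nilp (F : Type u) [Field F] (n : ℕ) : Matrix (Fin n) (Fin n) F :=
  Matrix.of fun i j => if (i : ℕ) + 1 = j then 1 else 0

/-- The Jordan block `J(p, n) = id_n ⊗ x_p + N_n ⊗ id_{deg p}`. -/
noncomputable def jordanBlock {F : Type u} [Field F] (x : RootMatrices F) (p : Spec F) (n : ℕ) :
    Matrix (Fin n × Fin p.deg) (Fin n × Fin p.deg) F :=
  (1 : Matrix (Fin n) (Fin n) F) ⊗ₖ x p + nilp F n ⊗ₖ (1 : Matrix (Fin p.deg) (Fin p.deg) F)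

/-- The labels `(p, n, α)`, `α ∈ ℵ(p, n)`, of the Jordan blocks; a cardinal is identified with
a representative set. -/
structure Block {F : Type u} [Field F] (m : MultFun.{u, w} F) where
  p : Spec F
  n : ℕ+
  α : (m p n).out

/-- The block space `F_pⁿ`, as the `F`-space `Fⁿ ⊗ F^(deg p)`. -/
abbrev BlockSpace {F : Type u} [Field F] {m : MultFun.{u, w} F} (b : Block m) : Type u :=
  Fin b.n × Fin b.p.deg → F

/-- The space `V` of dimension `dim_F ℵ`: the direct sum of all block spaces. -/
abbrev JordanSpace {F : Type u} [Field F] (m : MultFun.{u, w} F) : Type (max u w) :=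
  ⨁ b : Block m, BlockSpace b

/-- The Jordan canonical form `J(ℵ)`, the direct sum of the Jordan blocks. -/
noncomputable def jordanForm {F : Type u} [Field F] (x : RootMatrices F) (m : MultFun.{u, w} F) :
    Module.End F (JordanSpace m) :=
  DirectSum.lmap fun b : Block m => Matrix.toLin' (jordanBlock x b.p b.n)

/-! ### Almost Abelian Lie algebras -/

/-- The semidirect product `F e₀ ⋊ V`, with `V` Abelian and `ad e₀ = T` on `V`.
The element `⟨s, v⟩` is `s e₀ + v`. -/
@[ext]
structure SemiDirect {F : Type u} [Field F] {V : Type w} [AddCommGroup V] [Module F V]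
    (T : Module.End F V) : Type (max u w) where
  coef : F
  vec : V

namespace SemiDirect

variable {F : Type u} [Field F] {V : Type w} [AddCommGroup V] [Module F V] (T : Module.End F V)

/-- The underlying vector space is `F × V`. -/
def toProd : SemiDirect T ≃ F × V where
  toFun a := (a.coef, a.vec)
  invFun a := ⟨a.1, a.2⟩

instance : AddCommGroup (SemiDirect T) := (toProd T).addCommGroup

instance : Module F (SemiDirect T) := (toProd T).module F

/-- `[s e₀ + v, t e₀ + w] = s T w - t T v`. -/
instance : Bracket (SemiDirect T) (SemiDirect T) where
  bracket a b := ⟨0, a.coef • T b.vec - b.coef • T a.vec⟩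

@[simp] theorem zero_coef : (0 : SemiDirect T).coef = 0 := rfl
@[simp] theorem zero_vec : (0 : SemiDirect T).vec = 0 := rfl
@[simp] theorem add_coef (a b : SemiDirect T) : (a + b).coef = a.coef + b.coef := rfl
@[simp] theorem add_vec (a b : SemiDirect T) : (a + b).vec = a.vec + b.vec := rfl
@[simp] theorem smul_coef (c : F) (a : SemiDirect T) : (c • a).coef = c * a.coef := rfl
@[simp] theorem smul_vec (c : F) (a : SemiDirect T) : (c • a).vec = c • a.vec := rfl
@[simp] theorem lie_coef (a b : SemiDirect T) : ⁅a, b⁆.coef = 0 := rfl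
@[simp] theorem lie_vec (a b : SemiDirect T) :
    ⁅a, b⁆.vec = a.coef • T b.vec - b.coef • T a.vec := rfl

instance : LieRing (SemiDirect T) where
  add_lie a b c := by
    ext
    · simp
    · simp only [lie_vec, add_vec, add_coef, map_add]; module
  lie_add a b c := by
    ext
    · simp
    · simp only [lie_vec, add_vec, add_coef, map_add]; module
  lie_self a := by
    ext
    · simp
    · simp
  leibniz_lie a b c := by
    ext
    · simp
    · simp only [lie_vec, add_vec, lie_coef, map_sub, map_smul]; module

instance : LieAlgebra F (SemiDirect T) where
  lie_smul c a b := by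
    ext
    · simp
    · simp only [lie_vec, smul_vec, smul_coef, map_smul]; module

/-- The operator on `F e₀ ⋊ V` with block matrix `[[ν, 0], [γ, Δ]]`:
`e₀ ↦ ν e₀ + γ` and `v ↦ Δ v` for `v ∈ V`. -/
def blockOp (ν : F) (γ : V) (Δ : V →ₗ[F] V) : SemiDirect T →ₗ[F] SemiDirect T where
  toFun a := ⟨ν * a.coef, a.coef • γ + Δ a.vec⟩
  map_add' a b := by
    ext
    · simp only [add_coef]; ring
    · simp only [add_vec, add_coef, map_add]; module
  map_smul' c a := by
    ext
    · simp only [smul_coef, RingHom.id_apply]; ring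
    · simp only [smul_vec, smul_coef, map_smul, RingHom.id_apply]; module

end SemiDirect

/-- The canonical Jordanable Lie algebra `aA(ℵ) = F e₀ ⋊ V` with `ad e₀ = J(ℵ)`. -/
abbrev aA {F : Type u} [Field F] (x : RootMatrices F) (m : MultFun.{u, w} F) : Type (max u w) :=
  SemiDirect (jordanForm x m)

/-- A Lie algebra is indecomposable if it is not the direct sum of two nonzero ideals. -/
def Indecomposable (F : Type*) (L : Type*) [Field F] [LieRing L] [LieAlgebra F L] : Prop :=
  ∀ I J : LieIdeal F L, IsCompl I J → I = ⊥ ∨ J = ⊥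

/-- The Lie algebra is (isomorphic to) the Heisenberg algebra: it has a basis `x, y, z`
with `[x, y] = z` and `z` central. -/
def IsHeisenberg (F : Type*) (L : Type*) [Field F] [LieRing L] [LieAlgebra F L] : Prop :=
  ∃ b : Module.Basis (Fin 3) F L, ⁅b 0, b 1⁆ = b 2 ∧ ⁅b 0, b 2⁆ = 0 ∧ ⁅b 1, b 2⁆ = 0

/-! ### The block form of automorphisms -/

/-- The matrix `V_n(c) = diag(c, c², …, cⁿ)`. -/
def diagPow {F : Type u} [Field F] (n : ℕ) (c : F) : Matrix (Fin n) (Fin n) F :=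
  Matrix.diagonal fun i => c ^ ((i : ℕ) + 1)

/-- The `n × m` block matrix, with blocks of size `d × d`, that carries the upper triangular
Toeplitz matrix with first row `r₁, …, r_l`, `l = min m n`, in its `l × l` top right corner,
and zeros elsewhere. -/
def toeplitz {F : Type u} [Field F] {d : ℕ} (m n : ℕ)
    (r : Fin (min m n) → Matrix (Fin d) (Fin d) F) :
    Matrix (Fin n × Fin d) (Fin m × Fin d) F :=
  Matrix.of fun a b =>
    if h : (a.1 : ℕ) + (m - min m n) ≤ (b.1 : ℕ) then
      r ⟨(b.1 : ℕ) - (m - min m n) - (a.1 : ℕ), by have := b.1.isLt; have := a.1.isLt; omega⟩ a.2 b.2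
    else 0

/-- The block of an operator on `V` with row label `b'` and column label `b`. -/
noncomputable def blockOf {F : Type u} [Field F] {m : MultFun.{u, w} F}
    (Δ : JordanSpace m →ₗ[F] JordanSpace m) (b' b : Block m) :
    Matrix (Fin b'.n × Fin b'.p.deg) (Fin b.n × Fin b.p.deg) F :=
  open Classical in
  LinearMap.toMatrix' (DirectSum.component F (Block m) (fun c => BlockSpace c) b' ∘ₗ Δ ∘ₗ
    DirectSum.lof F (Block m) (fun c => BlockSpace c) b)

/-- `A = δ_{p, ν ⋆ q} (V_n(ν⁻¹) ⊗ V_d(t)) R`, for the row label `b' = (q, n, β)` and the column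
label `b = (p, m, α)`, where `d = deg p = deg q` and `R` is Toeplitz with entries in the field
`F_p = F[x_p]` of `d × d` matrices. -/
def IsAutBlock {F : Type u} [Field F] (x : RootMatrices F) {m : MultFun.{u, w} F}
    (ν : Fˣ) (t : F) (b' b : Block m)
    (A : Matrix (Fin b'.n × Fin b'.p.deg) (Fin b.n × Fin b.p.deg) F) : Prop :=
  (b.p ≠ ν • b'.p → A = 0) ∧
  ∀ h : b.p = ν • b'.p,
    ∃ r : Fin (min (b.n : ℕ) b'.n) → Algebra.adjoin F {x b.p},
      A = (diagPow b'.n (ν : F)⁻¹ ⊗ₖ diagPow b'.p.deg t) *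
        (toeplitz b.n b'.n fun i => (r i : Matrix (Fin b.p.deg) (Fin b.p.deg) F)).submatrix
          (Prod.map id (Fin.cast (by rw [h, Spec.deg_smul]))) id

/-- The operators `[[ν, 0], [γ, Δ]]` on `aA(ℵ)` with `ν` a dilation symmetry of `ℵ`, `γ ∈ V`
arbitrary, and `Δ` an invertible operator on `V` whose blocks are
`δ_{p, ν ⋆ q} (V_n(ν⁻¹) ⊗ V_d(s ν)) R`, finitely many of them nonzero in every column. -/
def autForms {F : Type u} [Field F] (x : RootMatrices F) (s : Fˣ → F) (m : MultFun.{u, w} F) :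
    Set (aA x m →ₗ[F] aA x m) :=
  {φ | ∃ ν ∈ m.Dil, ∃ γ : JordanSpace m, ∃ Δ : JordanSpace m ≃ₗ[F] JordanSpace m,
    φ = SemiDirect.blockOp (jordanForm x m) (ν : F) γ Δ ∧
    (∀ b' b : Block m, IsAutBlock x ν (s ν) b' b
      (blockOf (Δ : JordanSpace m →ₗ[F] JordanSpace m) b' b)) ∧
    ∀ b : Block m, {b' | blockOf (Δ : JordanSpace m →ₗ[F] JordanSpace m) b' b ≠ 0}.Finite}

/-- The automorphisms of a Lie algebra, as a set of linear operators. -/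
def autSet (F : Type*) (L : Type*) [Field F] [LieRing L] [LieAlgebra F L] : Set (L →ₗ[F] L) :=
  {φ | ∃ ψ : L ≃ₗ⁅F⁆ L, ∀ a, φ a = ψ a}

end JordanableAA

namespace JordanableAA

section Sylvester

theorem eq_zero_of_isUnit_mul {F ι κ : Type*} [Field F] [Fintype ι] [DecidableEq ι]
    {U : Matrix ι ι F} {A : Matrix ι κ F} (hU : IsUnit U)
    (h : U * A = 0) : A = 0 := by
  obtain ⟨u, rfl⟩ := hU
  have : ((u⁻¹ : (Matrix ι ι F)ˣ) : Matrix ι ι F) * ((u : Matrix ι ι F) * A) = 0 := by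
    rw [h]; simp
  rwa [← Matrix.mul_assoc, Units.inv_mul, Matrix.one_mul] at this

variable {F : Type*} [Field F] {ι κ : Type*} [Fintype ι] [Fintype κ]

/-- The Sylvester operator `A ↦ A S - S' A`. -/
def sylvester (S' : Matrix ι ι F) (S : Matrix κ κ F) : Module.End F (Matrix ι κ F) :=
  mulRightLinearMap ι F S - mulLeftLinearMap κ F S'

theorem sylvester_apply (S' : Matrix ι ι F) (S : Matrix κ κ F) (A : Matrix ι κ F) :
    sylvester S' S A = A * S - S' * A := rfl

theorem commute_sylvester {S' N' : Matrix ι ι F} {S N : Matrix κ κ F} (h' : Commute S' N')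
    (h : Commute S N) : Commute (sylvester S' S) (sylvester N' N) := by
  refine LinearMap.ext fun A => ?_
  have e1 := h.eq
  have e2 := h'.eq
  simp only [Module.End.mul_apply, sylvester_apply, Matrix.sub_mul,
    Matrix.mul_sub, Matrix.mul_assoc, e1]
  rw [← Matrix.mul_assoc S' N', e2, Matrix.mul_assoc]
  abel

variable [DecidableEq ι] [DecidableEq κ]

theorem isNilpotent_sylvester {N' : Matrix ι ι F} {N : Matrix κ κ F} (h' : IsNilpotent N')
    (h : IsNilpotent N) : IsNilpotent (sylvester N' N) := by
  refine Commute.isNilpotent_sub ?_ ?_ ?_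
  · refine LinearMap.ext fun A => ?_
    simp [Matrix.mul_assoc]
  · obtain ⟨k, hk⟩ := h
    refine ⟨k, LinearMap.ext fun A => ?_⟩
    have : ∀ j, (mulRightLinearMap ι F N ^ j : Module.End F (Matrix ι κ F)) A = A * N ^ j := by
      intro j
      induction j with
      | zero => simp
      | succ j ih => rw [pow_succ', Module.End.mul_apply, ih]; simp [pow_succ, Matrix.mul_assoc]
    rw [this, hk]; simp
  · obtain ⟨k, hk⟩ := h'
    refine ⟨k, LinearMap.ext fun A => ?_⟩
    have : ∀ j, (mulLeftLinearMap κ F N' ^ j : Module.End F (Matrix ι κ F)) A = N' ^ j * A := by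
      intro j
      induction j with
      | zero => simp
      | succ j ih => rw [pow_succ', Module.End.mul_apply, ih]; simp [pow_succ', Matrix.mul_assoc]
    rw [this, hk]; simp

theorem mul_aeval_of_mul_eq {S' : Matrix ι ι F} {S : Matrix κ κ F} {A : Matrix ι κ F}
    (h : A * S = S' * A) (f : F[X]) : A * aeval S f = aeval S' f * A := by
  induction f using Polynomial.induction_on' with
  | add p q hp hq => simp [Matrix.mul_add, Matrix.add_mul, hp, hq]
  | monomial n a =>
    have : ∀ n : ℕ, A * S ^ n = S' ^ n * A := by
      intro n
      induction n with
      | zero => simp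
      | succ n ih => rw [pow_succ, ← Matrix.mul_assoc, ih, Matrix.mul_assoc, h, pow_succ,
          Matrix.mul_assoc]
    simp [aeval_monomial, Algebra.algebraMap_eq_smul_one, this]

theorem mul_aeval_sub_aeval_mul {S' : Matrix ι ι F} {S : Matrix κ κ F} {A : Matrix ι κ F}
    (h : sylvester S' S (sylvester S' S A) = 0) (f : F[X]) :
    A * aeval S f - aeval S' f * A = aeval S' (derivative f) * sylvester S' S A := by
  set B := sylvester S' S A with hB
  rw [sylvester_apply, sub_eq_zero] at h
  rw [sylvester_apply] at hB
  induction f using Polynomial.induction_on' with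
  | add p q hp hq =>
    simp only [map_add, Matrix.mul_add, Matrix.add_mul, ← hp, ← hq]
    abel
  | monomial n a =>
    have : ∀ n : ℕ, A * S ^ n - S' ^ n * A = (n : F) • (S' ^ (n - 1) * B) := by
      intro n
      induction n with
      | zero => simp
      | succ n ih =>
        have e : A * S ^ (n + 1) - S' ^ (n + 1) * A =
            (A * S ^ n - S' ^ n * A) * S + S' ^ n * B := by
          rw [hB, pow_succ, pow_succ]
          simp only [Matrix.sub_mul, Matrix.mul_sub, Matrix.mul_assoc]
          abel
        rw [e, ih]
        rcases n with _ | n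
        · simp
        · rw [Matrix.smul_mul, Matrix.mul_assoc, h, ← Matrix.mul_assoc]
          simp only [Nat.add_sub_cancel, ← pow_succ]
          push_cast
          module
    simp only [aeval_monomial, Algebra.algebraMap_eq_smul_one, derivative_monomial,
      Matrix.smul_mul, Matrix.mul_smul, one_mul, ← smul_sub, this, smul_smul]

theorem isUnit_aeval_of_isCoprime {S : Matrix κ κ F} {p f : F[X]} (hp : aeval S p = 0)
    (h : IsCoprime p f) : IsUnit (aeval S f) := by
  obtain ⟨a, b, hab⟩ := h
  have := congrArg (aeval S) hab
  simp only [map_add, map_mul, hp, mul_zero, zero_add, map_one] at this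
  exact IsUnit.of_mul_eq_one_right _ this

theorem sylvester_injective_of_isCoprime {S' : Matrix ι ι F} {S : Matrix κ κ F} {p q : F[X]}
    (hp : aeval S p = 0) (hq : aeval S' q = 0) (h : IsCoprime p q) {A : Matrix ι κ F}
    (hA : sylvester S' S A = 0) : A = 0 := by
  rw [sylvester_apply, sub_eq_zero] at hA
  have := mul_aeval_of_mul_eq hA p
  rw [hp, Matrix.mul_zero] at this
  exact eq_zero_of_isUnit_mul (isUnit_aeval_of_isCoprime hq h.symm) this.symm

theorem sylvester_eq_zero_of_separable {S' : Matrix ι ι F} {S : Matrix κ κ F} {p : F[X]}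
    (hp : aeval S p = 0) (hq : aeval S' p = 0) (h : p.Separable) {A : Matrix ι κ F}
    (hA : sylvester S' S (sylvester S' S A) = 0) : sylvester S' S A = 0 := by
  have := mul_aeval_sub_aeval_mul hA p
  rw [hp, hq, Matrix.mul_zero, Matrix.zero_mul, sub_zero] at this
  exact eq_zero_of_isUnit_mul (isUnit_aeval_of_isCoprime hq h) this.symm

theorem eq_zero_of_pow_apply_eq_zero {V : Type*} [AddCommGroup V] [Module F V]
    {C : Module.End F V} (hC : ∀ v, C (C v) = 0 → C v = 0) {k : ℕ} {v : V}
    (h : (C ^ k) v = 0) : C v = 0 := by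
  induction k with
  | zero => simp at h; simp [h]
  | succ k ih =>
    rcases k with _ | k
    · simpa using h
    · apply ih
      rw [pow_succ', pow_succ', Module.End.mul_apply, Module.End.mul_apply] at h
      rw [pow_succ', Module.End.mul_apply]
      exact hC _ h

theorem exists_sylvester_pow_eq_zero {S' N' : Matrix ι ι F} {S N : Matrix κ κ F}
    (hS' : Commute S' N') (hS : Commute S N) (hN' : IsNilpotent N') (hN : IsNilpotent N)
    {A : Matrix ι κ F} (hA : A * (S + N) = (S' + N') * A) :
    ∃ k, (sylvester S' S ^ k) A = 0 := by
  have h1 : sylvester S' S A = (-sylvester N' N) A := by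
    rw [LinearMap.neg_apply, sylvester_apply, sylvester_apply]
    rw [Matrix.mul_add, Matrix.add_mul] at hA
    rw [sub_eq_iff_eq_add, eq_sub_of_add_eq hA]
    abel
  have hc : Commute (sylvester S' S) (-sylvester N' N) := (commute_sylvester hS' hS).neg_right
  obtain ⟨k, hk⟩ := (isNilpotent_sylvester hN' hN).neg
  have h2 : ∀ j, (sylvester S' S ^ j) A = ((-sylvester N' N) ^ j) A := by
    intro j
    induction j with
    | zero => rfl
    | succ j ih =>
      rw [pow_succ', Module.End.mul_apply, ih, ← Module.End.mul_apply, (hc.pow_right j).eq,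
        Module.End.mul_apply, h1, ← Module.End.mul_apply, ← pow_succ]
  exact ⟨k, by rw [h2, hk]; rfl⟩

theorem eq_zero_of_intertwine {S' N' : Matrix ι ι F} {S N : Matrix κ κ F}
    (hS' : Commute S' N') (hS : Commute S N) (hN' : IsNilpotent N') (hN : IsNilpotent N)
    {p q : F[X]} (hp : aeval S p = 0) (hq : aeval S' q = 0) (h : IsCoprime p q)
    {A : Matrix ι κ F} (hA : A * (S + N) = (S' + N') * A) : A = 0 := by
  obtain ⟨k, hk⟩ := exists_sylvester_pow_eq_zero hS' hS hN' hN hA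
  exact sylvester_injective_of_isCoprime hp hq h (eq_zero_of_pow_apply_eq_zero
    (fun v hv => sylvester_injective_of_isCoprime hp hq h hv) hk)

theorem mul_eq_of_intertwine {S' N' : Matrix ι ι F} {S N : Matrix κ κ F}
    (hS' : Commute S' N') (hS : Commute S N) (hN' : IsNilpotent N') (hN : IsNilpotent N)
    {p : F[X]} (hp : aeval S p = 0) (hq : aeval S' p = 0)
    (h : p.Separable ∨ N' = 0 ∧ N = 0)
    {A : Matrix ι κ F} (hA : A * (S + N) = (S' + N') * A) :
    A * S = S' * A ∧ A * N = N' * A := by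
  have key : A * S = S' * A := by
    rcases h with h | ⟨h', h⟩
    · obtain ⟨k, hk⟩ := exists_sylvester_pow_eq_zero hS' hS hN' hN hA
      exact sub_eq_zero.1 (eq_zero_of_pow_apply_eq_zero
        (fun v hv => sylvester_eq_zero_of_separable hp hq h hv) hk)
    · simpa [h, h'] using hA
  refine ⟨key, ?_⟩
  rwa [Matrix.mul_add, Matrix.add_mul, key, add_right_inj] at hA

end Sylvester

section Centralizer

variable {F : Type*} [Field F]

/-- A square matrix of size `deg p` annihilated by an irreducible polynomial `p` is cyclic, so that
every matrix that commutes with it is a polynomial in it. -/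
theorem mem_adjoin_of_commute {p : F[X]} (hp : Irreducible p) {d : ℕ} (hd : p.natDegree = d)
    {x : Matrix (Fin d) (Fin d) F} (hx : aeval x p = 0) {M : Matrix (Fin d) (Fin d) F}
    (h : Commute M x) : M ∈ Algebra.adjoin F {x} := by
  have hd0 : 0 < d := hd ▸ hp.natDegree_pos
  let e : Fin d → F := Pi.single ⟨0, hd0⟩ 1
  have he : e ≠ 0 := by simp [e]
  have hunit : ∀ f : F[X], ¬ p ∣ f → ∀ v : Fin d → F, (aeval x f).mulVec v = 0 → v = 0 := by
    intro f hf v hv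
    obtain ⟨u, hu⟩ := isUnit_aeval_of_isCoprime hx ((hp.coprime_iff_not_dvd).2 hf)
    have : ((u⁻¹ : (Matrix (Fin d) (Fin d) F)ˣ) : Matrix (Fin d) (Fin d) F).mulVec
        ((u : Matrix (Fin d) (Fin d) F).mulVec v) = 0 := by
      rw [hu, hv, Matrix.mulVec_zero]
    rwa [Matrix.mulVec_mulVec, Units.inv_mul, Matrix.one_mulVec] at this
  let Φ : degreeLT F d →ₗ[F] (Fin d → F) :=
    { toFun := fun f => (aeval x (f : F[X])).mulVec e
      map_add' := fun f g => by simp [Matrix.add_mulVec]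
      map_smul' := fun c f => by simp [Matrix.smul_mulVec] }
  have hΦ : Function.Injective Φ := by
    rw [injective_iff_map_eq_zero]
    intro f hf
    by_contra hne
    have hne' : (f : F[X]) ≠ 0 := fun h => hne (Subtype.ext h)
    refine he (hunit f (fun hdvd => ?_) e hf)
    have h1 := degree_le_of_dvd hdvd hne'
    have h2 := mem_degreeLT.1 f.2
    rw [degree_eq_natDegree hp.ne_zero, hd] at h1
    exact absurd h2 (not_lt.2 h1)
  have hfin : Module.finrank F (degreeLT F d) = Module.finrank F (Fin d → F) :=
    (degreeLTEquiv F d).finrank_eq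
  have : Module.Finite F (degreeLT F d) := Module.Finite.equiv (degreeLTEquiv F d).symm
  have hsurj := (LinearMap.injective_iff_surjective_of_finrank_eq_finrank hfin).1 hΦ
  obtain ⟨f, hf⟩ := hsurj (M.mulVec e)
  have hM : M = aeval x (f : F[X]) := by
    apply Matrix.toLin'.injective
    refine LinearMap.ext fun v => ?_
    obtain ⟨g, rfl⟩ := hsurj v
    have c1 : M * aeval x (g : F[X]) = aeval x (g : F[X]) * M := mul_aeval_of_mul_eq h.eq _
    have hf' : (aeval x (f : F[X])).mulVec e = M.mulVec e := hf
    change M.mulVec ((aeval x (g : F[X])).mulVec e) =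
      (aeval x (f : F[X])).mulVec ((aeval x (g : F[X])).mulVec e)
    rw [Matrix.mulVec_mulVec, c1, ← Matrix.mulVec_mulVec, ← hf', Matrix.mulVec_mulVec,
      Matrix.mulVec_mulVec, ← map_mul, ← map_mul, mul_comm]
  rw [hM]
  exact aeval_mem_adjoin_singleton F x

theorem commute_of_mem_adjoin {d : ℕ} {x M : Matrix (Fin d) (Fin d) F}
    (h : M ∈ Algebra.adjoin F {x}) : M * x = x * M := by
  have : Algebra.adjoin F {x} ≤ Subalgebra.centralizer F {x} :=
    Algebra.adjoin_le (by simp [Set.mem_centralizer_iff])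
  exact ((Subalgebra.mem_centralizer_iff F).1 (this h) x rfl).symm

end Centralizer

section Toeplitz

variable {F : Type u} [Field F] {d : ℕ}

theorem mul_one_kronecker_apply {n m : ℕ} (R : Matrix (Fin n × Fin d) (Fin m × Fin d) F)
    (x : Matrix (Fin d) (Fin d) F) (a : Fin n × Fin d) (j : Fin m) (k : Fin d) :
    (R * ((1 : Matrix (Fin m) (Fin m) F) ⊗ₖ x)) a (j, k) = ∑ c, R a (j, c) * x c k := by
  simp [Matrix.mul_apply, Fintype.sum_prod_type_right, Matrix.one_apply]

theorem one_kronecker_mul_apply {n m : ℕ} (R : Matrix (Fin n × Fin d) (Fin m × Fin d) F)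
    (x : Matrix (Fin d) (Fin d) F) (i : Fin n) (k : Fin d) (b : Fin m × Fin d) :
    (((1 : Matrix (Fin n) (Fin n) F) ⊗ₖ x) * R) (i, k) b = ∑ c, x k c * R (i, c) b := by
  simp [Matrix.mul_apply, Fintype.sum_prod_type_right, Matrix.one_apply]

theorem nilp_kronecker_mulVec {n : ℕ} (v : Fin n × Fin d → F) (i : Fin n) (k : Fin d) :
    ((nilp F n ⊗ₖ (1 : Matrix (Fin d) (Fin d) F)).mulVec v) (i, k) =
      if h : (i : ℕ) + 1 < n then v (⟨i + 1, h⟩, k) else 0 := by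
  simp only [Matrix.mulVec, dotProduct, Fintype.sum_prod_type, Matrix.kronecker_apply,
    Matrix.one_apply, nilp, Matrix.of_apply, mul_ite, mul_one, mul_zero, ite_mul, zero_mul,
    Finset.sum_ite_eq, Finset.mem_univ, if_true, one_mul]
  split_ifs with h
  · rw [Finset.sum_eq_single ⟨i + 1, h⟩]
    · simp
    · intro b _ hb
      rw [if_neg]
      intro h'
      exact hb (Fin.ext h'.symm)
    · simp
  · refine Finset.sum_eq_zero fun b _ => if_neg fun h' => ?_
    have := b.2
    omega

theorem nilp_kronecker_mul_apply {n m : ℕ} (R : Matrix (Fin n × Fin d) (Fin m × Fin d) F)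
    (i : Fin n) (k : Fin d) (b : Fin m × Fin d) :
    ((nilp F n ⊗ₖ (1 : Matrix (Fin d) (Fin d) F)) * R) (i, k) b =
      if h : (i : ℕ) + 1 < n then R (⟨i + 1, h⟩, k) b else 0 :=
  nilp_kronecker_mulVec (fun a => R a b) i k

theorem mul_nilp_kronecker_apply {n m : ℕ} (R : Matrix (Fin n × Fin d) (Fin m × Fin d) F)
    (a : Fin n × Fin d) (j : Fin m) (k : Fin d) :
    (R * (nilp F m ⊗ₖ (1 : Matrix (Fin d) (Fin d) F))) a (j, k) =
      if (j : ℕ) = 0 then 0 else R a (⟨j - 1, by omega⟩, k) := by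
  simp only [Matrix.mul_apply, Fintype.sum_prod_type, Matrix.kronecker_apply,
    Matrix.one_apply, nilp, Matrix.of_apply, mul_ite, mul_one, mul_zero,
    Finset.sum_ite_eq', Finset.mem_univ, if_true]
  split_ifs with h
  · refine Finset.sum_eq_zero fun b _ => if_neg fun h' => ?_
    omega
  · rw [Finset.sum_eq_single ⟨j - 1, by omega⟩]
    · rw [if_pos]
      simp only
      omega
    · intro b _ hb
      rw [if_neg]
      intro h'
      apply hb
      apply Fin.ext
      simp only
      omega
    · simp

theorem nilp_kronecker_pow_mulVec {n : ℕ} (l : ℕ) (v : Fin n × Fin d → F) (i : Fin n)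
    (k : Fin d) :
    (((nilp F n ⊗ₖ (1 : Matrix (Fin d) (Fin d) F)) ^ l).mulVec v) (i, k) =
      if h : (i : ℕ) + l < n then v (⟨i + l, h⟩, k) else 0 := by
  induction l generalizing i with
  | zero => simp
  | succ l ih =>
    rw [pow_succ', ← Matrix.mulVec_mulVec, nilp_kronecker_mulVec]
    split_ifs with h1 h2 h2
    · rw [ih, dif_pos (by simp only; omega)]
      congr 3
      simp only
      omega
    · rw [ih, dif_neg (by simp only; omega)]
    · omega
    · rfl

theorem isNilpotent_nilp_kronecker (n d : ℕ) :
    IsNilpotent (nilp F n ⊗ₖ (1 : Matrix (Fin d) (Fin d) F)) := by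
  refine ⟨n, Matrix.toLin'.injective (LinearMap.ext fun v => funext fun a => ?_)⟩
  obtain ⟨i, k⟩ := a
  rw [Matrix.toLin'_apply, nilp_kronecker_pow_mulVec, dif_neg (by omega)]
  simp

theorem commute_one_kronecker (n : ℕ) (x : Matrix (Fin d) (Fin d) F) :
    Commute ((1 : Matrix (Fin n) (Fin n) F) ⊗ₖ x)
      (nilp F n ⊗ₖ (1 : Matrix (Fin d) (Fin d) F)) := by
  rw [Commute, SemiconjBy, ← Matrix.mul_kronecker_mul, ← Matrix.mul_kronecker_mul]
  simp

/-- An operator commutes with the semisimple and nilpotent parts of the Jordan blocks if and only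
if it is an upper triangular Toeplitz matrix over the field generated by `x`. -/
theorem exists_eq_toeplitz_iff {n m : ℕ} {x : Matrix (Fin d) (Fin d) F}
    (hx : ∀ M, Commute M x → M ∈ Algebra.adjoin F {x})
    (R : Matrix (Fin n × Fin d) (Fin m × Fin d) F) :
    (∃ r : Fin (min m n) → Algebra.adjoin F {x},
      R = toeplitz m n fun i => (r i : Matrix (Fin d) (Fin d) F)) ↔
    R * ((1 : Matrix (Fin m) (Fin m) F) ⊗ₖ x) = ((1 : Matrix (Fin n) (Fin n) F) ⊗ₖ x) * R ∧
    R * (nilp F m ⊗ₖ (1 : Matrix (Fin d) (Fin d) F)) =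
      (nilp F n ⊗ₖ (1 : Matrix (Fin d) (Fin d) F)) * R := by
  constructor
  · rintro ⟨r, rfl⟩
    constructor
    · ext ⟨i, a⟩ ⟨j, b⟩
      rw [mul_one_kronecker_apply, one_kronecker_mul_apply]
      simp only [toeplitz, Matrix.of_apply]
      split_ifs with h
      · have := congrFun (congrFun (commute_of_mem_adjoin
          (r ⟨(j : ℕ) - (m - min m n) - (i : ℕ), by omega⟩).2) a) b
        simpa only [Matrix.mul_apply] using this
      · simp
    · ext ⟨i, a⟩ ⟨j, b⟩
      rw [mul_nilp_kronecker_apply, nilp_kronecker_mul_apply]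
      simp only [toeplitz, Matrix.of_apply]
      have hj := j.2
      have hi := i.2
      split_ifs with h1 h2 h3 h3 h2 h3 h3
      · omega
      · rfl
      · rfl
      · have e : (j : ℕ) - 1 - (m - min m n) - i = j - (m - min m n) - (i + 1) := by omega
        simp only [e]
      · omega
      · omega
      · omega
      · rfl
      · rfl
  · rintro ⟨h1, h2⟩
    have h1' : ∀ i j a b, ∑ c, R (i, a) (j, c) * x c b = ∑ c, x a c * R (i, c) (j, b) := by
      intro i j a b
      rw [← mul_one_kronecker_apply, ← one_kronecker_mul_apply, h1]
    have h2' : ∀ (i : Fin n) (j : Fin m) a b, (if (j : ℕ) = 0 then 0 else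
        R (i, a) (⟨j - 1, by omega⟩, b)) =
        if h : (i : ℕ) + 1 < n then R (⟨i + 1, h⟩, a) (j, b) else 0 := by
      intro i j a b
      rw [← mul_nilp_kronecker_apply, ← nilp_kronecker_mul_apply, h2]
    have hs : ∀ i j (hi : i + 1 < n) (hj : j + 1 < m) a b,
        R (⟨i + 1, hi⟩, a) (⟨j + 1, hj⟩, b) = R (⟨i, by omega⟩, a) (⟨j, by omega⟩, b) := by
      intro i j hi hj a b
      have := h2' ⟨i, by omega⟩ ⟨j + 1, hj⟩ a b
      rw [if_neg (by simp), dif_pos hi] at this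
      simpa using this.symm
    have hl : ∀ i (hi : i + 1 < n) (hm : 0 < m) a b, R (⟨i + 1, hi⟩, a) (⟨0, hm⟩, b) = 0 := by
      intro i hi hm a b
      have := h2' ⟨i, by omega⟩ ⟨0, hm⟩ a b
      rw [if_pos rfl, dif_pos hi] at this
      exact this.symm
    have hb : ∀ i j (hi : i < n) (hj : j + 1 < m) a b, i + 1 = n →
        R (⟨i, hi⟩, a) (⟨j, by omega⟩, b) = 0 := by
      intro i j hi hj a b h
      have := h2' ⟨i, hi⟩ ⟨j + 1, hj⟩ a b
      rw [if_neg (by simp), dif_neg (by simp only; omega)] at this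
      simpa using this
    refine ⟨fun k => ⟨Matrix.of fun a b => R (⟨0, by have := k.2; omega⟩, a)
      (⟨k + (m - min m n), by have := k.2; omega⟩, b), hx _ ?_⟩, ?_⟩
    · ext a b
      simpa only [Matrix.mul_apply, Matrix.of_apply] using h1' _ _ a b
    · ext ⟨⟨i, hi⟩, a⟩ ⟨⟨j, hj⟩, b⟩
      simp only [toeplitz, Matrix.of_apply]
      split_ifs with h
      · have key : ∀ (i j : ℕ) (hi : i < n) (hj : j < m) (h : i ≤ j),
            R (⟨i, hi⟩, a) (⟨j, hj⟩, b) = R (⟨0, by omega⟩, a) (⟨j - i, by omega⟩, b) := by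
          intro i
          induction i with
          | zero => intro j hi hj h; rfl
          | succ i ih =>
            intro j hi hj h
            obtain ⟨j, rfl⟩ : ∃ j', j = j' + 1 := ⟨j - 1, by omega⟩
            rw [hs, ih _ _ _ (by omega)]
            congr 3
            simp
        rw [key i j hi hj (by omega)]
        congr 3
        omega
      · rcases le_total m n with hmn | hmn
        · have key : ∀ (j i : ℕ) (hi : i < n) (hj : j < m) (h : j < i),
              R (⟨i, hi⟩, a) (⟨j, hj⟩, b) = 0 := by
            intro j
            induction j with
            | zero =>
              intro i hi hj h
              obtain ⟨i, rfl⟩ : ∃ i', i = i' + 1 := ⟨i - 1, by omega⟩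
              exact hl _ _ _ _ _
            | succ j ih =>
              intro i hi hj h
              obtain ⟨i, rfl⟩ : ∃ i', i = i' + 1 := ⟨i - 1, by omega⟩
              rw [hs]
              exact ih _ _ _ (by omega)
          exact key j i hi hj (by omega)
        · have key : ∀ (t i j : ℕ) (hi : i < n) (hj : j < m) (h : j < i + (m - n))
              (ht : i + 1 + t = n), R (⟨i, hi⟩, a) (⟨j, hj⟩, b) = 0 := by
            intro t
            induction t with
            | zero =>
              intro i j hi hj h ht
              exact hb i j hi (by omega) a b ht
            | succ t ih =>
              intro i j hi hj h ht
              rw [← hs i j (by omega) (by omega)]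
              exact ih _ _ _ _ (by omega) (by omega)
          exact key (n - i - 1) i j hi hj (by omega) (by omega)

end Toeplitz

section Dilation

variable {F : Type u} [Field F]

theorem isUnit_diagPow (n : ℕ) {c : F} (hc : c ≠ 0) : IsUnit (diagPow n c) := by
  rw [diagPow, Matrix.isUnit_diagonal]
  exact Pi.isUnit_iff.2 fun i => (pow_ne_zero _ hc).isUnit

theorem smul_nilp_mul_diagPow (n : ℕ) {c : F} (hc : c ≠ 0) :
    c • (nilp F n * diagPow n c⁻¹) = diagPow n c⁻¹ * nilp F n := by
  ext i j
  simp only [diagPow, nilp, Matrix.smul_apply, Matrix.mul_diagonal, Matrix.diagonal_mul,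
    Matrix.of_apply, smul_eq_mul]
  split_ifs with h
  · rw [← h, pow_succ]
    field_simp
  · simp

/-- Intertwiners between a Jordan block and a dilated Jordan block have the form
`(V_n(ν⁻¹) ⊗ V_d(t)) R` with `R` upper triangular Toeplitz. -/
theorem exists_eq_diagPow_mul_toeplitz_iff {n m d d' : ℕ} (e : d = d')
    {y : Matrix (Fin d) (Fin d) F} {x : Matrix (Fin d') (Fin d') F}
    (hx : ∀ M, Commute M x → M ∈ Algebra.adjoin F {x}) {c t : F} (hc : c ≠ 0) (ht : t ≠ 0)
    (hxy : c • (y * diagPow d t) = diagPow d t * x.submatrix (Fin.cast e) (Fin.cast e))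
    (A : Matrix (Fin n × Fin d) (Fin m × Fin d') F) :
    (∃ r : Fin (min m n) → Algebra.adjoin F {x},
      A = (diagPow n c⁻¹ ⊗ₖ diagPow d t) *
        (toeplitz m n fun i => (r i : Matrix (Fin d') (Fin d') F)).submatrix
          (Prod.map id (Fin.cast e)) id) ↔
    A * ((1 : Matrix (Fin m) (Fin m) F) ⊗ₖ x) =
      (c • ((1 : Matrix (Fin n) (Fin n) F) ⊗ₖ y)) * A ∧
    A * (nilp F m ⊗ₖ (1 : Matrix (Fin d') (Fin d') F)) =
      (c • (nilp F n ⊗ₖ (1 : Matrix (Fin d) (Fin d) F))) * A := by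
  subst e
  simp only [Fin.cast_refl, Prod.map_id, Matrix.submatrix_id_id] at hxy ⊢
  set G := diagPow n c⁻¹ ⊗ₖ diagPow d t with hG
  have hunit : IsUnit G := by
    rw [hG]
    exact Matrix.IsUnit.kronecker (isUnit_diagPow n (inv_ne_zero hc)) (isUnit_diagPow d ht)
  have g1 : (c • ((1 : Matrix (Fin n) (Fin n) F) ⊗ₖ y)) * G =
      G * ((1 : Matrix (Fin n) (Fin n) F) ⊗ₖ x) := by
    rw [hG, Matrix.smul_mul, ← Matrix.mul_kronecker_mul, ← Matrix.mul_kronecker_mul,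
      ← Matrix.kronecker_smul, hxy, Matrix.one_mul, Matrix.mul_one]
  have g2 : (c • (nilp F n ⊗ₖ (1 : Matrix (Fin d) (Fin d) F))) * G =
      G * (nilp F n ⊗ₖ (1 : Matrix (Fin d) (Fin d) F)) := by
    rw [hG, Matrix.smul_mul, ← Matrix.mul_kronecker_mul, ← Matrix.mul_kronecker_mul,
      ← Matrix.smul_kronecker, smul_nilp_mul_diagPow n hc, Matrix.one_mul, Matrix.mul_one]
  obtain ⟨u, hu⟩ := hunit
  have hcancel : ∀ B C : Matrix (Fin n × Fin d) (Fin m × Fin d) F, G * B = G * C ↔ B = C := by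
    intro B C
    refine ⟨fun h => ?_, fun h => by rw [h]⟩
    refine sub_eq_zero.1 (eq_zero_of_isUnit_mul ⟨u, hu⟩ ?_)
    rw [Matrix.mul_sub, h, sub_self]
  obtain ⟨R, rfl⟩ : ∃ R : Matrix (Fin n × Fin d) (Fin m × Fin d) F, A = G * R := by
    refine ⟨(u⁻¹ : (Matrix (Fin n × Fin d) (Fin n × Fin d) F)ˣ).val * A, ?_⟩
    rw [← Matrix.mul_assoc, ← hu, Units.mul_inv, Matrix.one_mul]
  simp only [← Matrix.mul_assoc, g1, g2]
  simp only [Matrix.mul_assoc, hcancel]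
  exact exists_eq_toeplitz_iff hx R

end Dilation

section Spectrum

variable {F : Type u} [Field F]

theorem Spec.isCoprime_of_ne {p q : Spec F} (h : p ≠ q) : IsCoprime p.1 q.1 := by
  rw [p.2.2.coprime_iff_not_dvd]
  exact fun hd => h (Subtype.ext
    (eq_of_monic_of_associated p.2.1 q.2.1 (p.2.2.associated_of_dvd q.2.2 hd)))

theorem Spec.coeff_smul (c : Fˣ) (p : Spec F) (i : ℕ) :
    (c • p).1.coeff i = p.1.coeff i * (c : F) ^ (p.deg - i) :=
  coeff_scaleRoots _ _ _

theorem Spec.separable_smul (c : Fˣ) {p : Spec F} (h : p.1.Separable) :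
    (c • p).1.Separable := by
  rw [separable_iff_derivative_ne_zero (c • p).2.2]
  rw [separable_iff_derivative_ne_zero p.2.2] at h
  contrapose! h
  ext i
  have := congrArg (fun f => coeff f i) h
  simp only [coeff_derivative, Spec.coeff_smul, coeff_zero] at this ⊢
  have hc : (c : F) ^ (p.deg - (i + 1)) ≠ 0 := pow_ne_zero _ c.ne_zero
  rw [mul_right_comm] at this
  exact (mul_eq_zero.1 this).resolve_right hc

/-- The root matrices `x_p`, together with a scale `s` such that `V_d(s ν)` intertwines `x_(ν ⋆ q)`
and `ν x_q`. -/
structure Admissible (x : RootMatrices F) (s : Fˣ → F) : Prop where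
  aeval_eq_zero : ∀ p, aeval (x p) p.1 = 0
  ne_zero : ∀ c, s c ≠ 0
  smul_mul : ∀ (c : Fˣ) (q : Spec F), (c : F) • (x q * diagPow q.deg (s c)) =
    diagPow q.deg (s c) * (x (c • q)).submatrix (Fin.cast (Spec.deg_smul c q).symm)
      (Fin.cast (Spec.deg_smul c q).symm)

theorem aeval_one_kronecker {d : ℕ} (n : ℕ) (x : Matrix (Fin d) (Fin d) F) (f : F[X]) :
    aeval ((1 : Matrix (Fin n) (Fin n) F) ⊗ₖ x) f =
      (1 : Matrix (Fin n) (Fin n) F) ⊗ₖ aeval x f := by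
  induction f using Polynomial.induction_on' with
  | add p q hp hq => rw [map_add, map_add, hp, hq, Matrix.kronecker_add]
  | monomial k a =>
    have : ∀ k : ℕ, ((1 : Matrix (Fin n) (Fin n) F) ⊗ₖ x) ^ k = 1 ⊗ₖ (x ^ k) := by
      intro k
      induction k with
      | zero => simp
      | succ k ih => rw [pow_succ, ih, ← Matrix.mul_kronecker_mul, Matrix.one_mul, pow_succ]
    simp [aeval_monomial, Algebra.algebraMap_eq_smul_one, this, Matrix.kronecker_smul]

theorem nilp_kronecker_eq_zero {n d : ℕ} (hn : n = 1) :
    nilp F n ⊗ₖ (1 : Matrix (Fin d) (Fin d) F) = 0 := by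
  subst hn
  have : nilp F 1 = 0 := by
    ext i j
    simp [nilp]
  rw [this, Matrix.zero_kronecker]

theorem smul_jordanBlock (x : RootMatrices F) (q : Spec F) (n : ℕ) (c : F) :
    c • jordanBlock x q n = c • ((1 : Matrix (Fin n) (Fin n) F) ⊗ₖ x q) +
      c • (nilp F n ⊗ₖ (1 : Matrix (Fin q.deg) (Fin q.deg) F)) := by
  rw [jordanBlock, smul_add]

variable {x : RootMatrices F} {s : Fˣ → F} {m : MultFun.{u, w} F}

theorem Block.separable {b : Block m} (hm : ∀ (p : Spec F) (n : ℕ+), 2 ≤ n → m p n ≠ 0 →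
    p.1.Separable) (h : b.n ≠ 1) : b.p.1.Separable := by
  refine hm b.p b.n ?_ ?_
  · have h1 : (b.n : ℕ) ≠ 1 := fun h' => h (PNat.coe_eq_one_iff.1 h')
    have h2 := b.n.pos
    rw [← PNat.coe_le_coe]
    change 2 ≤ (b.n : ℕ)
    omega
  · rw [← Cardinal.mk_out (m b.p b.n)]
    have : Nonempty (m b.p b.n).out := ⟨b.α⟩
    exact Cardinal.mk_ne_zero _

theorem isAutBlock_iff (hx : Admissible x s)
    (hm : ∀ (p : Spec F) (n : ℕ+), 2 ≤ n → m p n ≠ 0 → p.1.Separable) (ν : Fˣ) (b' b : Block m)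
    (A : Matrix (Fin b'.n × Fin b'.p.deg) (Fin b.n × Fin b.p.deg) F) :
    IsAutBlock x ν (s ν) b' b A ↔
      A * jordanBlock x b.p b.n = ((ν : F) • jordanBlock x b'.p b'.n) * A := by
  have key : ∀ h : b.p = ν • b'.p, (∃ r : Fin (min (b.n : ℕ) b'.n) → Algebra.adjoin F {x b.p},
      A = (diagPow b'.n (ν : F)⁻¹ ⊗ₖ diagPow b'.p.deg (s ν)) *
        (toeplitz b.n b'.n fun i => (r i : Matrix (Fin b.p.deg) (Fin b.p.deg) F)).submatrix
          (Prod.map id (Fin.cast (by rw [h, Spec.deg_smul]))) id) ↔ _ := fun h =>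
    exists_eq_diagPow_mul_toeplitz_iff (n := b'.n) (m := b.n) (e := by rw [h, Spec.deg_smul])
      (y := x b'.p) (x := x b.p)
      (fun M hM => mem_adjoin_of_commute b.p.2.2 rfl (hx.aeval_eq_zero b.p) hM) ν.ne_zero
      (hx.ne_zero ν) (by
        rw [hx.smul_mul]
        congr 1
        generalize b.p = p at h
        subst h
        rfl) A
  have haux : aeval ((ν : F) • ((1 : Matrix (Fin b'.n) (Fin b'.n) F) ⊗ₖ x b'.p))
      (ν • b'.p).1 = 0 := by
    have := scaleRoots_aeval_eq_zero (r := (ν : F)) (p := b'.p.1)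
      (a := (1 : Matrix (Fin b'.n) (Fin b'.n) F) ⊗ₖ x b'.p)
      (by rw [aeval_one_kronecker, hx.aeval_eq_zero, Matrix.kronecker_zero])
    rwa [← Algebra.smul_def] at this
  have haux' : aeval ((1 : Matrix (Fin b.n) (Fin b.n) F) ⊗ₖ x b.p) b.p.1 = 0 := by
    rw [aeval_one_kronecker, hx.aeval_eq_zero, Matrix.kronecker_zero]
  have hc' := ((commute_one_kronecker b'.n (x b'.p)).smul_left (ν : F)).smul_right (ν : F)
  have hc := commute_one_kronecker b.n (x b.p)
  have hn' := (isNilpotent_nilp_kronecker (F := F) b'.n b'.p.deg).smul (ν : F)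
  have hn := isNilpotent_nilp_kronecker (F := F) b.n b.p.deg
  rw [smul_jordanBlock, jordanBlock]
  constructor
  · rintro ⟨h1, h2⟩
    by_cases h : b.p = ν • b'.p
    · obtain ⟨e1, e2⟩ := (key h).1 (h2 h)
      rw [Matrix.mul_add, Matrix.add_mul, e1, e2]
    · simp [h1 h]
  · intro hA
    refine ⟨fun h => ?_, fun h => (key h).2 ?_⟩
    · exact eq_zero_of_intertwine hc' hc hn' hn haux' haux (Spec.isCoprime_of_ne h) hA
    · refine mul_eq_of_intertwine hc' hc hn' hn haux' (by rw [h]; exact haux) ?_ hA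
      by_cases hb : b.n = 1
      · by_cases hb' : b'.n = 1
        · exact Or.inr ⟨by rw [nilp_kronecker_eq_zero (PNat.coe_eq_one_iff.2 hb'), smul_zero],
            nilp_kronecker_eq_zero (PNat.coe_eq_one_iff.2 hb)⟩
        · left
          rw [h]
          exact Spec.separable_smul ν (Block.separable hm hb')
      · exact Or.inl (Block.separable hm hb)

theorem IsAutBlock.mul_nilp (hx : Admissible x s) {ν : Fˣ} {b' b : Block m}
    {A : Matrix (Fin b'.n × Fin b'.p.deg) (Fin b.n × Fin b.p.deg) F}
    (hA : IsAutBlock x ν (s ν) b' b A) :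
    A * (nilp F b.n ⊗ₖ (1 : Matrix (Fin b.p.deg) (Fin b.p.deg) F)) =
      ((ν : F) • (nilp F b'.n ⊗ₖ (1 : Matrix (Fin b'.p.deg) (Fin b'.p.deg) F))) * A := by
  by_cases h : b.p = ν • b'.p
  · exact ((exists_eq_diagPow_mul_toeplitz_iff (n := b'.n) (m := b.n)
      (e := by rw [h, Spec.deg_smul]) (y := x b'.p) (x := x b.p)
      (fun M hM => mem_adjoin_of_commute b.p.2.2 rfl (hx.aeval_eq_zero b.p) hM) ν.ne_zero
      (hx.ne_zero ν) (by
        rw [hx.smul_mul]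
        congr 1
        generalize b.p = p at h
        subst h
        rfl) A).1 (hA.2 h)).2
  · simp [hA.1 h]

end Spectrum

section RootMatrices

theorem admissible_companion (F : Type u) [Field F] :
    Admissible (companion F) fun c : Fˣ => (c : F) where
  aeval_eq_zero p := by
    have h : companion F p = Algebra.leftMulMatrix (AdjoinRoot.powerBasis' p.2.1).basis
        (AdjoinRoot.powerBasis' p.2.1).gen := by
      have hmin : minpoly F (AdjoinRoot.powerBasis' p.2.1).gen = p.1 := by
        rw [AdjoinRoot.powerBasis'_gen, AdjoinRoot.minpoly_root p.2.2.ne_zero,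
          p.2.1.leadingCoeff, inv_one, C_1, mul_one]
      rw [PowerBasis.leftMulMatrix, PowerBasis.minpolyGen_eq, hmin]
      rfl
    rw [h]
    change aeval (Algebra.leftMulMatrix (AdjoinRoot.powerBasis' p.2.1).basis
        (AdjoinRoot.powerBasis' p.2.1).gen) p.1 = 0
    rw [aeval_algHom_apply]
    simp
  ne_zero c := c.ne_zero
  smul_mul c q := by
    ext i j
    simp only [diagPow, companion, Matrix.smul_apply, Matrix.mul_diagonal, Matrix.diagonal_mul,
      Matrix.of_apply, Matrix.submatrix_apply, smul_eq_mul, Spec.deg_smul, Fin.val_cast,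
      Spec.coeff_smul]
    split_ifs with h1 h2
    · rw [h1]
      have : (c : F) ^ q.deg = (c : F) ^ (i : ℕ) * (c : F) ^ (q.deg - i) := by
        rw [← pow_add]
        congr 1
        have := i.2
        omega
      rw [this]
      ring
    · rw [h2]
      ring
    · simp

theorem Spec.deg_eq_one_or_two (p : Spec ℝ) : p.deg = 1 ∨ p.deg = 2 := by
  have h1 := p.2.2.natDegree_le_two
  have h2 := p.2.2.natDegree_pos
  rw [Spec.deg]
  omega

theorem Spec.discr_nonneg {p : Spec ℝ} (hp : p.deg = 2) :
    0 ≤ p.1.coeff 0 - (p.1.coeff 1 / 2) ^ 2 := by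
  by_contra! h
  have hd : p.1.natDegree = 2 := hp
  have hl : p.1.coeff 2 = 1 := by
    have := p.2.1.coeff_natDegree
    rwa [hd] at this
  refine p.2.2.not_isRoot_of_natDegree_ne_one (by omega)
    (x := -p.1.coeff 1 / 2 + Real.sqrt (-(p.1.coeff 0 - (p.1.coeff 1 / 2) ^ 2))) ?_
  rw [IsRoot.def, eval_eq_sum_range, hd]
  simp only [Finset.sum_range_succ, Finset.sum_range_zero, hl]
  have := Real.sq_sqrt (show 0 ≤ -(p.1.coeff 0 - (p.1.coeff 1 / 2) ^ 2) by linarith)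
  linear_combination this

theorem aeval_realForm_of_deg_eq_two {d : ℕ} (hd : d = 2) {f : ℝ[X]} (hf : f.natDegree = 2)
    (hm : f.Monic) {u v : ℝ} (hu : u = -f.coeff 1 / 2) (hv : v ^ 2 = f.coeff 0 - u ^ 2) :
    aeval (Matrix.of fun i j : Fin d => if i = j then u else if i < j then -v else v) f = 0 := by
  subst hd
  have hl : f.coeff 2 = 1 := by
    have := hm.coeff_natDegree
    rwa [hf] at this
  rw [aeval_eq_sum_range, hf]
  simp only [Finset.sum_range_succ, Finset.sum_range_zero, hl]
  have h0 : f.coeff 0 = v ^ 2 + u ^ 2 := by linarith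
  have h1 : f.coeff 1 = -2 * u := by linarith
  rw [h0, h1]
  ext i j
  fin_cases i <;> fin_cases j <;> simp [pow_two, Matrix.mul_apply] <;> ring

theorem admissible_realForm :
    Admissible realForm fun c : ℝˣ => (c : ℝ) * |(c : ℝ)|⁻¹ where
  aeval_eq_zero p := by
    rcases p.deg_eq_one_or_two with h | h
    · have : realForm p = companion ℝ p := by
        ext i j
        simp [realForm, h]
      rw [this]
      exact (admissible_companion ℝ).aeval_eq_zero p
    · have := aeval_realForm_of_deg_eq_two h h p.2.1 rfl
        (v := Real.sqrt (p.1.coeff 0 - (p.1.coeff 1 / 2) ^ 2))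
        (by rw [Real.sq_sqrt (Spec.discr_nonneg h)]; ring)
      rw [← this]
      congr 1
      ext i j
      simp [realForm, h]
  ne_zero c := by simp
  smul_mul c q := by
    have hc : |(c : ℝ)| ≠ 0 := by simp
    have hc2 : |(c : ℝ)| ^ 2 = (c : ℝ) ^ 2 := sq_abs _
    have hval : ∀ i j : Fin q.deg, realForm (c • q) (Fin.cast (Spec.deg_smul c q).symm i)
        (Fin.cast (Spec.deg_smul c q).symm j) = if q.deg = 2 then
      if i = j then - (q.1.coeff 1 * c) / 2
      else if i < j then - (|(c : ℝ)| * Real.sqrt (q.1.coeff 0 - (q.1.coeff 1 / 2) ^ 2))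
      else |(c : ℝ)| * Real.sqrt (q.1.coeff 0 - (q.1.coeff 1 / 2) ^ 2)
    else companion ℝ (c • q) (Fin.cast (Spec.deg_smul c q).symm i)
        (Fin.cast (Spec.deg_smul c q).symm j) := by
      intro i j
      simp only [realForm, Matrix.of_apply, Spec.deg_smul, Spec.coeff_smul]
      by_cases h : q.deg = 2
      · have hs : Real.sqrt (q.1.coeff 0 * (c : ℝ) ^ (q.deg - 0) -
            (q.1.coeff 1 * (c : ℝ) ^ (q.deg - 1) / 2) ^ 2)
            = |(c : ℝ)| * Real.sqrt (q.1.coeff 0 - (q.1.coeff 1 / 2) ^ 2) := by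
          rw [← Real.sqrt_sq_eq_abs, ← Real.sqrt_mul (sq_nonneg _), h]
          congr 1
          ring
        have h1 : (c : ℝ) ^ (q.deg - 1) = c := by rw [h]; simp
        rw [if_pos h, if_pos h]
        simp only [Fin.ext_iff, Fin.lt_def, Fin.val_cast]
        exact if_congr Iff.rfl (by rw [h1]) (if_congr Iff.rfl (by rw [← hs]) (by rw [← hs]))
      · rw [if_neg h, if_neg h]
    have hq : ∀ i j : Fin q.deg, realForm q i j = if q.deg = 2 then
      if i = j then - (q.1.coeff 1) / 2
      else if i < j then - Real.sqrt (q.1.coeff 0 - (q.1.coeff 1 / 2) ^ 2)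
      else Real.sqrt (q.1.coeff 0 - (q.1.coeff 1 / 2) ^ 2)
    else companion ℝ q i j := fun i j => rfl
    ext i j
    simp only [diagPow, Matrix.smul_apply, Matrix.mul_diagonal, Matrix.diagonal_mul,
      Matrix.submatrix_apply, smul_eq_mul, hval, hq]
    have ht : (c : ℝ) * |(c : ℝ)|⁻¹ * |(c : ℝ)| = c := inv_mul_cancel_right₀ hc _
    have ht2 : ((c : ℝ) * |(c : ℝ)|⁻¹) ^ 2 = 1 := by
      rw [mul_pow, inv_pow, hc2]
      exact mul_inv_cancel₀ (pow_ne_zero _ c.ne_zero)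
    generalize (c : ℝ) * |(c : ℝ)|⁻¹ = t at ht ht2 ⊢
    generalize Real.sqrt (q.1.coeff 0 - (q.1.coeff 1 / 2) ^ 2) = w
    rcases q.deg_eq_one_or_two with h | h
    · have hi : (i : ℕ) = 0 := by omega
      have hj : (j : ℕ) = 0 := by omega
      simp [h, hi, hj, companion, Spec.deg_smul, Spec.coeff_smul]
      ring
    · rw [if_pos h, if_pos h]
      have hi := i.2
      have hj := j.2
      split_ifs with h1 h2
      · rw [h1]
        ring
      · rw [Fin.lt_def] at h2
        have hi : (i : ℕ) = 0 := by omega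
        have hj : (j : ℕ) = 1 := by omega
        rw [hi, hj]
        linear_combination (-(c : ℝ) * w) * ht2 + w * ht
      · rw [Fin.lt_def] at h2
        rw [Fin.ext_iff] at h1
        have hi : (i : ℕ) = 1 := by omega
        have hj : (j : ℕ) = 0 := by omega
        rw [hi, hj]
        linear_combination (-t * w) * ht

end RootMatrices

section Blocks

variable {F : Type u} [Field F] {m : MultFun.{u, w} F}

theorem blockOf_comp_lmap (Δ : JordanSpace m →ₗ[F] JordanSpace m)
    (M : ∀ b : Block m, Matrix (Fin b.n × Fin b.p.deg) (Fin b.n × Fin b.p.deg) F)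
    (b' b : Block m) :
    blockOf (Δ ∘ₗ DirectSum.lmap fun b => Matrix.toLin' (M b)) b' b = blockOf Δ b' b * M b := by
  classical
  apply Matrix.toLin'.injective
  rw [Matrix.toLin'_mul, blockOf, blockOf, Matrix.toLin'_toMatrix', Matrix.toLin'_toMatrix']
  refine LinearMap.ext fun v => ?_
  simp only [LinearMap.comp_apply]
  rw [DirectSum.lmap_lof]

theorem blockOf_lmap_comp (Δ : JordanSpace m →ₗ[F] JordanSpace m)
    (M : ∀ b : Block m, Matrix (Fin b.n × Fin b.p.deg) (Fin b.n × Fin b.p.deg) F)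
    (b' b : Block m) :
    blockOf ((DirectSum.lmap fun b => Matrix.toLin' (M b)) ∘ₗ Δ) b' b =
      M b' * blockOf Δ b' b := by
  classical
  apply Matrix.toLin'.injective
  rw [Matrix.toLin'_mul, blockOf, blockOf, Matrix.toLin'_toMatrix', Matrix.toLin'_toMatrix']
  rfl

theorem blockOf_smul (c : F) (Δ : JordanSpace m →ₗ[F] JordanSpace m) (b' b : Block m) :
    blockOf (c • Δ) b' b = c • blockOf Δ b' b := by
  rw [blockOf, blockOf, LinearMap.smul_comp, LinearMap.comp_smul, map_smul]

theorem blockOf_injective {Δ Δ' : JordanSpace m →ₗ[F] JordanSpace m}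
    (h : ∀ b' b, blockOf Δ b' b = blockOf Δ' b' b) : Δ = Δ' := by
  classical
  refine DirectSum.linearMap_ext F fun b => LinearMap.ext fun v => DFinsupp.ext fun b' => ?_
  exact LinearMap.congr_fun (LinearMap.toMatrix'.injective (h b' b)) v

theorem comp_lmap_eq_iff (Δ : JordanSpace m →ₗ[F] JordanSpace m) (c : F)
    (M : ∀ b : Block m, Matrix (Fin b.n × Fin b.p.deg) (Fin b.n × Fin b.p.deg) F) :
    (Δ ∘ₗ DirectSum.lmap fun b => Matrix.toLin' (M b)) =
      c • ((DirectSum.lmap fun b => Matrix.toLin' (M b)) ∘ₗ Δ) ↔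
    ∀ b' b, blockOf Δ b' b * M b = (c • M b') * blockOf Δ b' b := by
  constructor
  · intro h b' b
    rw [← blockOf_comp_lmap, h, blockOf_smul, blockOf_lmap_comp, Matrix.smul_mul]
  · intro h
    refine blockOf_injective fun b' b => ?_
    rw [blockOf_comp_lmap, h, blockOf_smul, blockOf_lmap_comp, Matrix.smul_mul]

theorem finite_blockOf_ne_zero (Δ : JordanSpace m →ₗ[F] JordanSpace m) (b : Block m) :
    {b' | blockOf Δ b' b ≠ 0}.Finite := by
  classical
  refine Set.Finite.subset (Set.finite_iUnion fun i : Fin b.n × Fin b.p.deg =>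
    (DFinsupp.support (Δ (DirectSum.lof F (Block m) (fun c => BlockSpace c) b
      (Pi.single i 1)))).finite_toSet) fun b' hb' => ?_
  by_contra hn
  apply hb'
  ext i j
  simp only [Set.mem_iUnion, not_exists, Finset.mem_coe, DFinsupp.mem_support_toFun,
    not_not] at hn
  have := congrFun (hn j) i
  rw [blockOf, LinearMap.toMatrix'_apply]
  refine Eq.trans ?_ this
  change Δ _ b' i = Δ _ b' i
  congr! 4

theorem apply_eq_zero_of_blockOf {Δ : JordanSpace m →ₗ[F] JordanSpace m} {v : JordanSpace m}
    {b' : Block m} (h : ∀ b, v b ≠ 0 → blockOf Δ b' b = 0) : Δ v b' = 0 := by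
  classical
  rw [← DirectSum.sum_support_of v, map_sum, DFinsupp.finsetSum_apply]
  refine Finset.sum_eq_zero fun b hb => ?_
  have h0 := h b (DFinsupp.mem_support_iff.1 hb)
  rw [blockOf, map_eq_zero_iff _ LinearMap.toMatrix'.injective] at h0
  have := LinearMap.congr_fun h0 (v b)
  refine Eq.trans ?_ this
  change Δ _ b' = Δ _ b'
  congr! 4

theorem isAutBlock_blockOf_iff {x : RootMatrices F} {s : Fˣ → F} (hx : Admissible x s)
    (hm : ∀ (p : Spec F) (n : ℕ+), 2 ≤ n → m p n ≠ 0 → p.1.Separable) (ν : Fˣ)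
    (Δ : JordanSpace m →ₗ[F] JordanSpace m) :
    (∀ b' b, IsAutBlock x ν (s ν) b' b (blockOf Δ b' b)) ↔
      Δ ∘ₗ jordanForm x m = (ν : F) • (jordanForm x m ∘ₗ Δ) := by
  rw [jordanForm, comp_lmap_eq_iff]
  exact forall₂_congr fun b' b => isAutBlock_iff hx hm ν b' b _

end Blocks

section Multiplicity

variable {F : Type u} [Field F] {m : MultFun.{u, w} F}

/-- The nilpotent part of the Jordan canonical form. -/
noncomputable def nilForm (m : MultFun.{u, w} F) : Module.End F (JordanSpace m) :=
  DirectSum.lmap fun b : Block m =>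
    Matrix.toLin' (nilp F b.n ⊗ₖ (1 : Matrix (Fin b.p.deg) (Fin b.p.deg) F))

theorem nilForm_pow_apply (k : ℕ) (v : JordanSpace m) (b : Block m) (i : Fin b.n)
    (j : Fin b.p.deg) :
    (nilForm m ^ k) v b (i, j) = if h : (i : ℕ) + k < b.n then v b (⟨i + k, h⟩, j) else 0 := by
  have : (nilForm m ^ k) v b =
      ((nilp F b.n ⊗ₖ (1 : Matrix (Fin b.p.deg) (Fin b.p.deg) F)) ^ k).mulVec (v b) := by
    induction k with
    | zero => simp
    | succ k ih =>
      rw [pow_succ', pow_succ', Module.End.mul_apply, ← Matrix.mulVec_mulVec, ← ih]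
      rfl
  rw [this, nilp_kronecker_pow_mulVec]

theorem mem_range_nilForm_pow {k : ℕ} {v : JordanSpace m}
    (h : ∀ (b : Block m) (i : Fin b.n) (j : Fin b.p.deg), (b.n : ℕ) ≤ i + k → v b (i, j) = 0) :
    ∃ w, (nilForm m ^ k) w = v := by
  let U : ∀ b : Block m, BlockSpace b →ₗ[F] BlockSpace b := fun b =>
    { toFun := fun f a => if k ≤ (a.1 : ℕ) then f (⟨a.1 - k, by omega⟩, a.2) else 0
      map_add' := fun f g => by
        ext a
        by_cases h : k ≤ (a.1 : ℕ) <;> simp [h]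
      map_smul' := fun c f => by
        ext a
        by_cases h : k ≤ (a.1 : ℕ) <;> simp [h] }
  refine ⟨DirectSum.lmap U v, DFinsupp.ext fun b => funext fun ⟨i, j⟩ => ?_⟩
  rw [nilForm_pow_apply]
  split_ifs with hi
  · rw [DirectSum.lmap_apply]
    simp [U]
  · exact (h b i j (by omega)).symm

theorem pow_intertwine {Δ : JordanSpace m →ₗ[F] JordanSpace m} {c : F}
    (h : Δ ∘ₗ nilForm m = c • (nilForm m ∘ₗ Δ)) (k : ℕ) (v : JordanSpace m) :
    Δ ((nilForm m ^ k) v) = c ^ k • (nilForm m ^ k) (Δ v) := by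
  induction k generalizing v with
  | zero => simp
  | succ k ih =>
    have := LinearMap.congr_fun h v
    simp only [LinearMap.comp_apply, LinearMap.smul_apply] at this
    rw [pow_succ, Module.End.mul_apply, ih, this, map_smul, smul_smul, ← pow_succ,
      Module.End.mul_apply]

/-- The space spanned by the lowest vectors of the Jordan blocks `J(p, n)`. -/
abbrev SocleSpace (m : MultFun.{u, w} F) (p : Spec F) (n : ℕ+) : Type (max u w) :=
  ⨁ _ : (m p n).out, (Fin p.deg → F)

open Classical in
/-- The inclusion of the span of the lowest vectors of the blocks `J(p, n)`. -/
noncomputable def socleIncl (m : MultFun.{u, w} F) (p : Spec F) (n : ℕ+) :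
    SocleSpace m p n →ₗ[F] JordanSpace m :=
  DirectSum.toModule F _ _ fun α =>
    DirectSum.lof F (Block m) (fun c => BlockSpace c) ⟨p, n, α⟩ ∘ₗ
      LinearMap.pi fun a => if (a.1 : ℕ) = 0 then LinearMap.proj a.2 else 0

theorem socleIncl_apply (p : Spec F) (n : ℕ+) (y : SocleSpace m p n) (α : (m p n).out)
    (i : Fin n) (j : Fin p.deg) :
    socleIncl m p n y ⟨p, n, α⟩ (i, j) = if (i : ℕ) = 0 then y α j else 0 := by
  classical
  induction y using DirectSum.induction_on with
  | zero => simp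
  | add y z hy hz =>
    rw [map_add, DirectSum.add_apply, Pi.add_apply, hy, hz]
    split_ifs <;> simp
  | of β z =>
    rw [socleIncl, ← DirectSum.lof_eq_of F, DirectSum.toModule_lof]
    by_cases h : β = α
    · subst h
      rw [LinearMap.comp_apply, DirectSum.lof_apply, DirectSum.lof_apply]
      change (if (i : ℕ) = 0 then LinearMap.proj j else 0 : (Fin p.deg → F) →ₗ[F] F) z = _
      split_ifs <;> rfl
    · rw [LinearMap.comp_apply, DirectSum.lof_eq_of, DirectSum.lof_eq_of,
        DirectSum.of_eq_of_ne _ _ _ (fun h' => h (by simpa using h'.symm)),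
        DirectSum.of_eq_of_ne _ _ _ (fun h' => h h'.symm)]
      simp

theorem socleIncl_apply_eq_zero {p : Spec F} {n : ℕ+} (y : SocleSpace m p n) {b : Block m}
    (hb : b.p ≠ p ∨ b.n ≠ n) : socleIncl m p n y b = 0 := by
  classical
  induction y using DirectSum.induction_on with
  | zero => simp
  | add y z hy hz => rw [map_add, DirectSum.add_apply, hy, hz, add_zero]
  | of β z =>
    rw [socleIncl, ← DirectSum.lof_eq_of F, DirectSum.toModule_lof, LinearMap.comp_apply,
      DirectSum.lof_eq_of, DirectSum.of_eq_of_ne]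
    rintro rfl
    simp at hb

theorem socleIncl_apply_pos {p : Spec F} {n : ℕ+} (y : SocleSpace m p n) {b : Block m}
    {i : Fin b.n} (hi : (i : ℕ) ≠ 0 ∨ b.p ≠ p ∨ b.n ≠ n) (j : Fin b.p.deg) :
    socleIncl m p n y b (i, j) = 0 := by
  by_cases hb : b.p ≠ p ∨ b.n ≠ n
  · rw [socleIncl_apply_eq_zero y hb]
    rfl
  · obtain ⟨p', n', α⟩ := b
    push Not at hb
    obtain ⟨rfl, rfl⟩ : p' = p ∧ n' = n := hb
    rw [socleIncl_apply, if_neg]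
    simpa using hi

/-- The lowest components in the blocks `J(p, n)`. -/
noncomputable def socleProj (m : MultFun.{u, w} F) (p : Spec F) (n : ℕ+) :
    JordanSpace m →ₗ[F] SocleSpace m p n where
  toFun v := DFinsupp.mapRange (fun _ f j => f (⟨0, n.pos⟩, j)) (fun _ => rfl)
    (DFinsupp.comapDomain (fun α => (⟨p, n, α⟩ : Block m)) (fun α β h => by simpa using h) v)
  map_add' v w := DFinsupp.ext fun α => by
    simp
    rfl
  map_smul' c v := DFinsupp.ext fun α => by
    simp
    rfl

theorem socleProj_apply (p : Spec F) (n : ℕ+) (v : JordanSpace m) (α : (m p n).out)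
    (j : Fin p.deg) : socleProj m p n v α j = v ⟨p, n, α⟩ (⟨0, n.pos⟩, j) := by
  simp [socleProj]
  rfl

theorem rank_socleSpace (p : Spec F) (n : ℕ+) :
    Module.rank F (SocleSpace m p n) = Cardinal.lift.{u} (m p n) * (p.deg : Cardinal) := by
  rw [rank_directSum]
  simp

theorem socle_map_injective {ν : Fˣ} {Δ : JordanSpace m ≃ₗ[F] JordanSpace m}
    (hN : (Δ : JordanSpace m →ₗ[F] JordanSpace m) ∘ₗ nilForm m =
      (ν : F) • (nilForm m ∘ₗ (Δ : JordanSpace m →ₗ[F] JordanSpace m)))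
    (hb : ∀ b' b : Block m, b.p ≠ ν • b'.p →
      blockOf (Δ : JordanSpace m →ₗ[F] JordanSpace m) b' b = 0) (p : Spec F) (n : ℕ+) :
    Function.Injective (socleProj m (ν⁻¹ • p) n ∘ₗ
      (Δ : JordanSpace m →ₗ[F] JordanSpace m) ∘ₗ socleIncl m p n) := by
  rw [injective_iff_map_eq_zero]
  intro y hy
  obtain ⟨k, hk⟩ : ∃ k, (n : ℕ) = k + 1 := ⟨n - 1, by have := n.pos; omega⟩
  have hΔ : ∀ k v, Δ ((nilForm m ^ k) v) = (ν : F) ^ k • (nilForm m ^ k) (Δ v) :=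
    pow_intertwine hN
  set v := socleIncl m p n y with hv
  set z := Δ v with hz
  have hNv : (nilForm m ^ 1) v = 0 := by
    refine DFinsupp.ext fun b => funext fun ⟨i, j⟩ => ?_
    rw [nilForm_pow_apply]
    split_ifs with h
    · exact socleIncl_apply_pos y (Or.inl (by simp)) j
    · rfl
  obtain ⟨u, hu⟩ : ∃ u, (nilForm m ^ k) u = v := by
    refine mem_range_nilForm_pow fun b i j h => socleIncl_apply_pos y ?_ j
    by_cases hbn : b.n = n
    · left
      have := congrArg PNat.val hbn
      change (b.n : ℕ) = n at this
      omega
    · exact Or.inr (Or.inr hbn)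
  have hz1 : ∀ (b : Block m) (i : Fin b.n) (j : Fin b.p.deg), (i : ℕ) ≠ 0 →
      z b (i, j) = 0 := by
    intro b i j hi
    have h1 := hΔ 1 v
    rw [hNv, map_zero, eq_comm, smul_eq_zero] at h1
    have h2 := h1.resolve_left (pow_ne_zero _ ν.ne_zero)
    have h3 := congrFun (DFunLike.congr_fun h2 b) (⟨i - 1, by have := i.2; omega⟩, j)
    rw [nilForm_pow_apply, dif_pos (by have := i.2; simp only; omega)] at h3
    have e : (⟨(i : ℕ) - 1 + 1, by have := i.2; omega⟩ : Fin b.n) = i :=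
      Fin.ext (by simp only; omega)
    rw [← e]
    exact h3
  have hz2 : ∀ (b : Block m) (i : Fin b.n) (j : Fin b.p.deg), (b.n : ℕ) ≤ i + k →
      z b (i, j) = 0 := by
    intro b i j hi
    have h1 := hΔ k u
    rw [hu] at h1
    rw [hz, h1, DirectSum.smul_apply, Pi.smul_apply, nilForm_pow_apply, dif_neg (by omega),
      smul_zero]
  have hz3 : ∀ (b : Block m) (i : Fin b.n) (j : Fin b.p.deg), (b.n : ℕ) ≤ i + (k + 1) →
      z b (i, j) = 0 := by
    intro b i j hi
    by_cases h1 : (b.n : ℕ) ≤ i + k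
    · exact hz2 b i j h1
    by_cases h2 : (i : ℕ) = 0
    · have hn : b.n = n := PNat.coe_injective (by omega)
      by_cases hp : b.p = ν⁻¹ • p
      · obtain ⟨q, n', α⟩ := b
        obtain rfl : q = ν⁻¹ • p := hp
        obtain rfl : n' = n := hn
        have h3 := congrFun (DFunLike.congr_fun hy α) j
        change socleProj m (ν⁻¹ • p) n' z α j = _ at h3
        rw [socleProj_apply] at h3
        obtain rfl : i = ⟨0, n'.pos⟩ := Fin.ext h2
        exact h3
      · have : z b = 0 := by
          refine apply_eq_zero_of_blockOf fun b₀ hb₀ => hb b b₀ fun h => hp ?_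
          have : b₀.p = p := by
            by_contra hne
            exact hb₀ (socleIncl_apply_eq_zero y (Or.inl hne))
          rw [← this, h, inv_smul_smul]
        rw [this]
        rfl
    · exact hz1 b i j h2
  obtain ⟨w, hw⟩ := mem_range_nilForm_pow hz3
  obtain ⟨t, rfl⟩ := Δ.surjective w
  have hvt : (ν : F) ^ (k + 1) • v = (nilForm m ^ (k + 1)) t := by
    apply Δ.injective
    rw [hΔ, map_smul, hw]
  refine DFinsupp.ext fun α => funext fun j => ?_
  have h1 := congrFun (DFunLike.congr_fun hvt ⟨p, n, α⟩) (⟨0, n.pos⟩, j)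
  rw [nilForm_pow_apply, dif_neg (by simp only; omega), DirectSum.smul_apply, Pi.smul_apply,
    socleIncl_apply, if_pos rfl, smul_eq_zero] at h1
  exact h1.resolve_left (pow_ne_zero _ ν.ne_zero)

theorem _root_.Cardinal.le_of_mul_natCast_le {a b : Cardinal.{w}} {d : ℕ} (hd : d ≠ 0)
    (h : a * d ≤ b * d) : a ≤ b := by
  have hd1 : (1 : Cardinal.{w}) ≤ d := by exact_mod_cast Nat.one_le_iff_ne_zero.2 hd
  have ha : a ≤ a * d := le_mul_of_one_le_right zero_le hd1
  rcases lt_or_ge b Cardinal.aleph0 with hb | hb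
  · obtain ⟨b, rfl⟩ := Cardinal.lt_aleph0.1 hb
    obtain ⟨a, rfl⟩ := Cardinal.lt_aleph0.1 ((ha.trans h).trans_lt
      (Cardinal.mul_lt_aleph0 hb (Cardinal.natCast_lt_aleph0)))
    norm_cast at h ⊢
    exact Nat.le_of_mul_le_mul_right h (Nat.pos_of_ne_zero hd)
  · refine (ha.trans h).trans ?_
    exact (Cardinal.mul_le_max_of_aleph0_le_left hb).trans
      (max_le le_rfl (Cardinal.natCast_lt_aleph0.le.trans hb))

theorem mult_le_of_intertwine {x : RootMatrices F} {s : Fˣ → F} (hx : Admissible x s)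
    (hm : ∀ (p : Spec F) (n : ℕ+), 2 ≤ n → m p n ≠ 0 → p.1.Separable) {ν : Fˣ}
    {Δ : JordanSpace m ≃ₗ[F] JordanSpace m}
    (h : (Δ : JordanSpace m →ₗ[F] JordanSpace m) ∘ₗ jordanForm x m =
      (ν : F) • (jordanForm x m ∘ₗ (Δ : JordanSpace m →ₗ[F] JordanSpace m)))
    (p : Spec F) (n : ℕ+) : m p n ≤ m (ν⁻¹ • p) n := by
  rw [← isAutBlock_blockOf_iff hx hm] at h
  have hN := (comp_lmap_eq_iff (Δ : JordanSpace m →ₗ[F] JordanSpace m) ν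
    (fun b => nilp F b.n ⊗ₖ (1 : Matrix (Fin b.p.deg) (Fin b.p.deg) F))).2
    fun b' b => (h b' b).mul_nilp hx
  have := LinearMap.rank_le_of_injective _
    (socle_map_injective hN (fun b' b => (h b' b).1) p n)
  rw [rank_socleSpace, rank_socleSpace, Spec.deg_smul] at this
  exact Cardinal.lift_le.1 (Cardinal.le_of_mul_natCast_le p.2.2.natDegree_pos.ne' this)

theorem mem_dil_of_intertwine {x : RootMatrices F} {s : Fˣ → F} (hx : Admissible x s)
    (hm : ∀ (p : Spec F) (n : ℕ+), 2 ≤ n → m p n ≠ 0 → p.1.Separable) {ν : Fˣ}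
    {Δ : JordanSpace m ≃ₗ[F] JordanSpace m}
    (h : (Δ : JordanSpace m →ₗ[F] JordanSpace m) ∘ₗ jordanForm x m =
      (ν : F) • (jordanForm x m ∘ₗ (Δ : JordanSpace m →ₗ[F] JordanSpace m))) :
    ν ∈ m.Dil := by
  have h' : (Δ.symm : JordanSpace m →ₗ[F] JordanSpace m) ∘ₗ jordanForm x m =
      ((ν⁻¹ : Fˣ) : F) • (jordanForm x m ∘ₗ (Δ.symm : JordanSpace m →ₗ[F] JordanSpace m)) := by
    refine LinearMap.ext fun v => Δ.injective ?_
    have := LinearMap.congr_fun h (Δ.symm v)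
    simp only [LinearMap.comp_apply, LinearMap.smul_apply, LinearEquiv.coe_coe,
      LinearEquiv.apply_symm_apply, map_smul] at this ⊢
    rw [this, smul_smul, Units.inv_mul, one_smul]
  refine funext fun p => funext fun n => le_antisymm ?_ (mult_le_of_intertwine hx hm h p n)
  have := mult_le_of_intertwine hx hm h' (ν⁻¹ • p) n
  rwa [inv_inv, smul_inv_smul] at this

end Multiplicity

namespace SemiDirect

variable {F : Type u} [Field F] {V : Type w} [AddCommGroup V] [Module F V] {T : Module.End F V}

theorem isLieAbelian_of_eq_zero (h : T = 0) : IsLieAbelian (SemiDirect T) := by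
  subst h
  exact ⟨fun a b => by ext <;> simp⟩

/-- If `ad e₀` is a square-zero operator of rank one, then the algebra is the direct sum of the
Heisenberg algebra and an Abelian algebra. -/
theorem isHeisenberg_of_rank_one {ℓ : V →ₗ[F] F} {y : V} (hy : ℓ y = 1)
    (hT : ∀ v, T v = ℓ v • T y) (hz : T y ≠ 0) (hTz : ℓ (T y) = 0)
    (hI : Indecomposable F (SemiDirect T)) : IsHeisenberg F (SemiDirect T) := by
  obtain ⟨g, hgz, hgy⟩ : ∃ g : V →ₗ[F] F, g (T y) = 1 ∧ g y = 0 := by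
    obtain ⟨g, hg⟩ := Module.Projective.exists_dual_eq_one F hz
    exact ⟨g - g y • ℓ, by simp [hg, hTz], by simp [hy]⟩
  let K : LieIdeal F (SemiDirect T) :=
    { carrier := {a | a.coef = 0 ∧ ℓ a.vec = 0 ∧ g a.vec = 0}
      add_mem' := by
        rintro a b ⟨h1, h2, h3⟩ ⟨h4, h5, h6⟩
        simp [h1, h2, h3, h4, h5, h6]
      zero_mem' := by simp
      smul_mem' := by
        rintro c a ⟨h1, h2, h3⟩
        simp [h1, h2, h3]
      lie_mem := by
        rintro a b ⟨h1, h2, h3⟩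
        simp [h1, hT b.vec, h2] }
  let I : LieIdeal F (SemiDirect T) :=
    { carrier := {a | a.vec = ℓ a.vec • y + g a.vec • T y}
      add_mem' := by
        intro a b (h1 : _ = _) (h2 : _ = _)
        change a.vec + b.vec = ℓ (a.vec + b.vec) • y + g (a.vec + b.vec) • T y
        rw [map_add, map_add]
        nth_rw 1 [h1, h2]
        module
      zero_mem' := by simp
      smul_mem' := by
        intro c a (h1 : _ = _)
        change c • a.vec = ℓ (c • a.vec) • y + g (c • a.vec) • T y
        rw [map_smul, map_smul]
        nth_rw 1 [h1]
        module
      lie_mem := by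
        intro a b _
        change a.coef • T b.vec - b.coef • T a.vec = ℓ (a.coef • T b.vec - b.coef • T a.vec) • y +
          g (a.coef • T b.vec - b.coef • T a.vec) • T y
        rw [hT a.vec, hT b.vec]
        simp only [map_sub, map_smul, hTz, hgz, smul_eq_mul, mul_one, mul_zero, sub_zero]
        module }
  have hcompl : IsCompl I K := by
    rw [← LieSubmodule.isCompl_toSubmodule]
    constructor
    · rw [Submodule.disjoint_def]
      rintro a (h1 : _ = _) ⟨h2, h3, h4⟩
      rw [h3, h4, zero_smul, zero_smul, zero_add] at h1
      ext
      · exact h2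
      · exact h1
    · rw [codisjoint_iff, Submodule.eq_top_iff']
      intro a
      have h1 : (⟨a.coef, ℓ a.vec • y + g a.vec • T y⟩ : SemiDirect T) ∈ I := by
        change ℓ a.vec • y + g a.vec • T y = ℓ (ℓ a.vec • y + g a.vec • T y) • y +
          g (ℓ a.vec • y + g a.vec • T y) • T y
        simp [hy, hgy, hTz, hgz]
      have h2 : (⟨0, a.vec - (ℓ a.vec • y + g a.vec • T y)⟩ : SemiDirect T) ∈ K := by
        refine ⟨rfl, ?_, ?_⟩ <;> simp [hy, hgy, hTz, hgz]
      refine Submodule.mem_sup.2 ⟨_, h1, _, h2, ?_⟩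
      ext <;> simp
  have hI0 : I ≠ ⊥ := by
    intro h
    have : (⟨1, 0⟩ : SemiDirect T) ∈ I := by
      change (0 : V) = ℓ 0 • y + g 0 • T y
      simp
    rw [h, LieSubmodule.mem_bot] at this
    exact one_ne_zero (congrArg coef this)
  have hK : K = ⊥ := (hI I K hcompl).resolve_left hI0
  have hv : ∀ v, v = ℓ v • y + g v • T y := by
    intro v
    have : (⟨0, v - (ℓ v • y + g v • T y)⟩ : SemiDirect T) ∈ K := by
      refine ⟨rfl, ?_, ?_⟩ <;> simp [hy, hgy, hTz, hgz]
    rw [hK, LieSubmodule.mem_bot] at this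
    exact sub_eq_zero.1 (congrArg vec this)
  let e : SemiDirect T ≃ₗ[F] (Fin 3 → F) :=
    { toFun := fun a => ![a.coef, ℓ a.vec, g a.vec]
      invFun := fun f => ⟨f 0, f 1 • y + f 2 • T y⟩
      map_add' := fun a b => by
        ext i
        fin_cases i <;> simp
      map_smul' := fun c a => by
        ext i
        fin_cases i <;> simp
      left_inv := fun a => by
        ext
        · rfl
        · exact (hv a.vec).symm
      right_inv := fun f => by
        ext i
        fin_cases i <;> simp [hy, hgy, hTz, hgz] }
  have e0 : Module.Basis.ofEquivFun e 0 = ⟨1, 0⟩ := by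
    rw [Module.Basis.coe_ofEquivFun]
    ext <;> simp [e]
  have e1 : Module.Basis.ofEquivFun e 1 = ⟨0, y⟩ := by
    rw [Module.Basis.coe_ofEquivFun]
    ext <;> simp [e]
  have e2 : Module.Basis.ofEquivFun e 2 = ⟨0, T y⟩ := by
    rw [Module.Basis.coe_ofEquivFun]
    ext <;> simp [e]
  refine ⟨Module.Basis.ofEquivFun e, ?_, ?_, ?_⟩
  · rw [e0, e1, e2]
    ext <;> simp
  · rw [e0, e2]
    ext
    · simp
    · simp [hT (T y), hTz]
  · rw [e1, e2]
    ext <;> simp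

/-- The Abelian ideal `V` is invariant under automorphisms. -/
theorem coef_apply_eq_zero (hA : ¬ IsLieAbelian (SemiDirect T))
    (hI : Indecomposable F (SemiDirect T)) (hH : ¬ IsHeisenberg F (SemiDirect T))
    (ψ : SemiDirect T ≃ₗ⁅F⁆ SemiDirect T) (v : V) : (ψ ⟨0, v⟩).coef = 0 := by
  by_contra hc
  let ℓ : V →ₗ[F] F :=
    { toFun := fun v => (ψ.symm ⟨0, v⟩).coef
      map_add' := fun a b => by
        have : (⟨0, a + b⟩ : SemiDirect T) = ⟨0, a⟩ + ⟨0, b⟩ := by ext <;> simp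
        rw [this, map_add, add_coef]
      map_smul' := fun c a => by
        have : (⟨0, c • a⟩ : SemiDirect T) = c • ⟨0, a⟩ := by ext <;> simp
        rw [this, map_smul, smul_coef]
        rfl }
  have h1 : ∀ u, ℓ u = 0 → T u = 0 := by
    intro u hu
    have h2 : ⁅(⟨0, v⟩ : SemiDirect T), ψ.symm ⟨0, u⟩⁆ = 0 := by
      ext
      · simp
      · have : (ψ.symm ⟨0, u⟩).coef = 0 := hu
        simp [this]
    have h3 := congrArg ψ h2
    rw [LieEquiv.map_lie, LieEquiv.apply_symm_apply, map_zero] at h3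
    have h4 := congrArg vec h3
    simp only [lie_vec, zero_smul, sub_zero, zero_vec, smul_eq_zero] at h4
    exact h4.resolve_left hc
  have h2 : ∀ u, ℓ (T u) = 0 := by
    intro u
    have : (⟨0, T u⟩ : SemiDirect T) = ⁅(⟨1, 0⟩ : SemiDirect T), (⟨0, u⟩ : SemiDirect T)⁆ := by
      ext <;> simp
    change (ψ.symm ⟨0, T u⟩).coef = 0
    rw [this, LieEquiv.map_lie, lie_coef]
  obtain ⟨y, hy⟩ : ∃ y, T y ≠ 0 := by
    by_contra! h
    exact hA (isLieAbelian_of_eq_zero (LinearMap.ext h))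
  have hℓ : ℓ y ≠ 0 := fun h => hy (h1 y h)
  refine hH (isHeisenberg_of_rank_one (ℓ := ℓ) (y := (ℓ y)⁻¹ • y) ?_ ?_ ?_ (h2 _) hI)
  · simp [hℓ]
  · intro u
    have h3 := h1 (u - (ℓ u * (ℓ y)⁻¹) • y) (by simp [hℓ])
    rw [map_sub, map_smul, sub_eq_zero] at h3
    rw [h3, map_smul, smul_smul]
  · simp [hℓ, hy]

theorem mem_autSet_blockOp {ν : Fˣ} {γ : V} {Δ : V ≃ₗ[F] V}
    (h : ∀ v, Δ (T v) = (ν : F) • T (Δ v)) :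
    blockOp T (ν : F) γ Δ ∈ autSet F (SemiDirect T) := by
  let f : SemiDirect T →ₗ⁅F⁆ SemiDirect T :=
    { blockOp T (ν : F) γ Δ with
      map_lie' := fun {a b} => by
        ext
        · simp [blockOp]
        · simp only [blockOp, AddHom.toFun_eq_coe, 
            AddHom.coe_mk, lie_vec, lie_coef, map_sub, map_smul, map_add, LinearEquiv.coe_coe,
            zero_smul, h]
          module }
  have hf : Function.Bijective f := by
    constructor
    · rw [injective_iff_map_eq_zero]
      intro a ha
      have h1 : (ν : F) * a.coef = 0 := congrArg coef ha
      have h2 : a.coef • γ + Δ a.vec = 0 := congrArg vec ha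
      have h3 := (mul_eq_zero.1 h1).resolve_left ν.ne_zero
      rw [h3, zero_smul, zero_add] at h2
      ext
      · exact h3
      · simpa using h2
    · intro b
      refine ⟨⟨(ν : F)⁻¹ * b.coef, Δ.symm (b.vec - ((ν : F)⁻¹ * b.coef) • γ)⟩, ?_⟩
      ext
      · change (ν : F) * ((ν : F)⁻¹ * b.coef) = _
        rw [mul_inv_cancel_left₀ ν.ne_zero]
      · change _ • γ + Δ (Δ.symm _) = _
        simp
  exact ⟨LieEquiv.ofBijective f hf, fun a => rfl⟩

theorem exists_blockOp_of_preserves {ψ : SemiDirect T ≃ₗ⁅F⁆ SemiDirect T}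
    (h : ∀ v, (ψ ⟨0, v⟩).coef = 0) (h' : ∀ v, (ψ.symm ⟨0, v⟩).coef = 0) :
    ∃ (ν : Fˣ) (γ : V) (Δ : V ≃ₗ[F] V), (∀ a, blockOp T (ν : F) γ Δ a = ψ a) ∧
      ∀ v, Δ (T v) = (ν : F) • T (Δ v) := by
  have hψ : ∀ v, ψ ⟨0, v⟩ = ⟨0, (ψ ⟨0, v⟩).vec⟩ := fun v => by
    ext
    · exact h v
    · rfl
  have hψ' : ∀ v, ψ.symm ⟨0, v⟩ = ⟨0, (ψ.symm ⟨0, v⟩).vec⟩ := fun v => by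
    ext
    · exact h' v
    · rfl
  have hdec : ∀ a : SemiDirect T, ψ a = a.coef • ψ ⟨1, 0⟩ + ψ ⟨0, a.vec⟩ := by
    intro a
    rw [← map_smul, ← map_add]
    congr 1
    ext <;> simp
  have hν : (ψ ⟨1, 0⟩).coef ≠ 0 := by
    intro h0
    have h1 := hdec (ψ.symm ⟨1, 0⟩)
    rw [LieEquiv.apply_symm_apply] at h1
    have h2 := congrArg coef h1
    simp [h0, h] at h2
  let Δ : V ≃ₗ[F] V :=
    { toFun := fun v => (ψ ⟨0, v⟩).vec
      invFun := fun v => (ψ.symm ⟨0, v⟩).vec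
      map_add' := fun a b => by
        have : (⟨0, a + b⟩ : SemiDirect T) = ⟨0, a⟩ + ⟨0, b⟩ := by ext <;> simp
        rw [this, map_add, add_vec]
      map_smul' := fun c a => by
        have : (⟨0, c • a⟩ : SemiDirect T) = c • ⟨0, a⟩ := by ext <;> simp
        rw [this, map_smul, smul_vec]
        rfl
      left_inv := fun v => by
        change (ψ.symm ⟨0, (ψ ⟨0, v⟩).vec⟩).vec = v
        rw [← hψ, LieEquiv.symm_apply_apply]
      right_inv := fun v => by
        change (ψ ⟨0, (ψ.symm ⟨0, v⟩).vec⟩).vec = v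
        rw [← hψ', LieEquiv.apply_symm_apply] }
  refine ⟨Units.mk0 _ hν, (ψ ⟨1, 0⟩).vec, Δ, fun a => ?_, fun v => ?_⟩
  · rw [hdec a]
    ext
    · change (ψ ⟨1, 0⟩).coef * a.coef = _
      simp [h, mul_comm]
    · rfl
  · have h1 : (⟨0, T v⟩ : SemiDirect T) = ⁅(⟨1, 0⟩ : SemiDirect T), (⟨0, v⟩ : SemiDirect T)⁆ := by
      ext <;> simp
    change (ψ ⟨0, T v⟩).vec = (ψ ⟨1, 0⟩).coef • T (ψ ⟨0, v⟩).vec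
    rw [h1, LieEquiv.map_lie, lie_vec, h v, zero_smul, sub_zero]

end SemiDirect

theorem autSet_eq_autForms {F : Type u} [Field F] {x : RootMatrices F} {s : Fˣ → F}
    (hx : Admissible x s) {m : MultFun.{u, w} F}
    (hm : ∀ (p : Spec F) (n : ℕ+), 2 ≤ n → m p n ≠ 0 → p.1.Separable)
    (hA : ¬ IsLieAbelian (aA x m)) (hI : Indecomposable F (aA x m))
    (hH : ¬ IsHeisenberg F (aA x m)) : autSet F (aA x m) = autForms x s m := by
  ext φ
  constructor
  · rintro ⟨ψ, hψ⟩
    obtain ⟨ν, γ, Δ, h1, h2⟩ := SemiDirect.exists_blockOp_of_preserves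
      (SemiDirect.coef_apply_eq_zero hA hI hH ψ) (SemiDirect.coef_apply_eq_zero hA hI hH ψ.symm)
    have h3 : (Δ : JordanSpace m →ₗ[F] JordanSpace m) ∘ₗ jordanForm x m =
        (ν : F) • (jordanForm x m ∘ₗ (Δ : JordanSpace m →ₗ[F] JordanSpace m)) :=
      LinearMap.ext h2
    exact ⟨ν, mem_dil_of_intertwine hx hm h3, γ, Δ,
      LinearMap.ext fun a => (hψ a).trans (h1 a).symm,
      (isAutBlock_blockOf_iff hx hm ν _).2 h3, finite_blockOf_ne_zero _⟩
  · rintro ⟨ν, -, γ, Δ, rfl, h, -⟩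
    exact SemiDirect.mem_autSet_blockOp
      (LinearMap.congr_fun ((isAutBlock_blockOf_iff hx hm ν _).1 h))

theorem diagPow_kronecker_diagPow {F : Type u} [Field F] (n d : ℕ) (a b : F) :
    Matrix.kronecker (diagPow n a) (diagPow d b) =
      Matrix.diagonal fun i : Fin n × Fin d => a ^ ((i.1 : ℕ) + 1) * b ^ ((i.2 : ℕ) + 1) := by
  rw [diagPow, diagPow, Matrix.kronecker, Matrix.kroneckerMap_diagonal_diagonal _ (by simp)
    (by simp)]

theorem inv_pow_mul_pow_eq_zpow {F : Type u} [Field F] {c : F} (hc : c ≠ 0) (i k : ℕ) :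
    c⁻¹ ^ (i + 1) * c ^ (k + 1) = c ^ ((k : ℤ) - (i : ℤ)) := by
  rw [zpow_sub₀ hc, zpow_natCast, zpow_natCast, inv_pow, pow_succ, pow_succ]
  field_simp

end JordanableAA

theorem mainTheorem1 :
    -- any field, with `x_p` the companion matrix of `p` (the case `ε = 1`)
    (∀ (F : Type u) [Field F] (m : JordanableAA.MultFun.{u, w} F),
      (∀ (p : JordanableAA.Spec F) (n : ℕ+), 2 ≤ n → m p n ≠ 0 → p.1.Separable) →
      ¬ IsLieAbelian (JordanableAA.aA (JordanableAA.companion F) m) →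
      JordanableAA.Indecomposable F (JordanableAA.aA (JordanableAA.companion F) m) →
      ¬ JordanableAA.IsHeisenberg F (JordanableAA.aA (JordanableAA.companion F) m) →
      JordanableAA.autSet F (JordanableAA.aA (JordanableAA.companion F) m) =
        JordanableAA.autForms (JordanableAA.companion F) (fun ν => (ν : F)) m) ∧
    -- the real field, with `x_p` in the traditional real form (the case `ε = 0`)
    (∀ m : JordanableAA.MultFun.{0, w} ℝ,
      ¬ IsLieAbelian (JordanableAA.aA JordanableAA.realForm m) →
      JordanableAA.Indecomposable ℝ (JordanableAA.aA JordanableAA.realForm m) →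
      ¬ JordanableAA.IsHeisenberg ℝ (JordanableAA.aA JordanableAA.realForm m) →
      JordanableAA.autSet ℝ (JordanableAA.aA JordanableAA.realForm m) =
        JordanableAA.autForms JordanableAA.realForm (fun ν => (ν : ℝ) * |(ν : ℝ)|⁻¹) m) ∧
    -- the explicit entries of `V_n(ν⁻¹) ⊗ V_d(ν |ν| ^ (ε - 1))` for `ε = 1` and `ε = 0`
    (∀ (F : Type u) [Field F] (ν : Fˣ) (n d : ℕ),
      Matrix.kronecker (JordanableAA.diagPow n (ν : F)⁻¹) (JordanableAA.diagPow d (ν : F)) =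
        Matrix.diagonal fun a : Fin n × Fin d => (ν : F) ^ (((a.2 : ℕ) : ℤ) - ((a.1 : ℕ) : ℤ))) ∧
    (∀ (ν : ℝˣ) (n d : ℕ),
      Matrix.kronecker (JordanableAA.diagPow n (ν : ℝ)⁻¹)
          (JordanableAA.diagPow d ((ν : ℝ) * |(ν : ℝ)|⁻¹)) =
        Matrix.diagonal fun a : Fin n × Fin d =>
          (ν : ℝ) ^ (((a.2 : ℕ) : ℤ) - ((a.1 : ℕ) : ℤ)) * |(ν : ℝ)|⁻¹ ^ ((a.2 : ℕ) + 1)) := by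
  refine ⟨fun F _ m hm => JordanableAA.autSet_eq_autForms (JordanableAA.admissible_companion F) hm,
    fun m => JordanableAA.autSet_eq_autForms JordanableAA.admissible_realForm
      fun p _ _ _ => p.2.2.separable, fun F _ ν n d => ?_, fun ν n d => ?_⟩
  · rw [JordanableAA.diagPow_kronecker_diagPow]
    congr 1
    funext a
    exact JordanableAA.inv_pow_mul_pow_eq_zpow ν.ne_zero _ _
  · rw [JordanableAA.diagPow_kronecker_diagPow]
    congr 1
    funext a
    rw [mul_pow, ← mul_assoc, JordanableAA.inv_pow_mul_pow_eq_zpow ν.ne_zero]
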